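/- Let $A=\mathbb{Z}[t]$ be the additive group of integer polynomials, ordered by declaring a nonzero polynomial positive iff its leading coefficient is positive. Let $G$ be a group generated by a subset $\Sigma$ with $1\notin\Sigma$, let $\Gamma=\Sigma\cup\Sigma^{-1}\subseteq G$ with $\overline a=a^{-1}$ for $a\in\Gamma$, and let $\pi:\Gamma^*\to G$ be the induced homomorphism from the free monoid. A (closed) word is a map $x:[1,\alpha]\to\Gamma$ with $0\le\alpha\in A$, where $[1,\alpha]=\{\beta\in A: 1\le\beta\le\alpha\}$; its length is $|x|=\alpha$. Under concatenation words form a monoid $W(A,\Gamma)$ with neutral element the empty word $1$, with involution $\overline x(\beta)=\overline{x(\alpha+1-\beta)}$, and containing $\Gamma^*$ as the set of words whose length is in $\mathbb{N}$. A word $x$ is *$G$-reduced* if no nonempty finite factor of $x$ represents $1$ in $G$, and *cyclically $G$-reduced* if $x^k$ is $G$-reduced for all $k\in\mathbb{N}$. A nonempty word $w$ is *primitive* if $w$ is a factor of $ww$ only as its prefix and as its suffix, and $\overline w$ is not a factor of $ww$. Let $R(A,G)$ be the set of $G$-reduced words, let $$M(A,G)=W(A,\Gamma)/\{u\,\ell\,\overline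 r\,\overline u=1 : u\in R(A,G),\ \ell,r\in\Gamma^*,\ \pi(\ell)=\pi(r)\},$$ and let $\mathrm{Ext}(A,G)$ be the image in $M(A,G)$ of the submonoid of $W(A,\Gamma)$ generated by $R(A,G)$; it is a group. Let $H$ be a finitely generated subgroup of $\mathrm{Ext}(A,G)$, and let $u,v,w$ be (not necessarily different) cyclically $G$-reduced words which represent elements of $H$ (also denoted $u,v,w$) and satisfy $|u|=|v|=|w|$. Suppose that the word $w$ is primitive and that the centralizers of $u$ and of $v$ in $H$ are cyclic. Then there is an isomorphism $\langle v\rangle\to\langle u\rangle$ with $v\mapsto u$, and the HNN extension $$H'=\langle H,s\mid s^{-1}us=v\rangle$$ embeds into $\mathrm{Ext}(A,G)$ by an injective homomorphism which restricts to the inclusion on $H$. -/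

import Mathlib

namespace InfWords

open Polynomial

/-- The additive group `A = ℤ[t]` of integer polynomials, viewed as a discretely ordered abelian
group: a nonzero polynomial is positive if its leading coefficient is positive. -/
def ZT : Type := ℤ[X]

noncomputable instance : CommRing ZT := inferInstanceAs (CommRing ℤ[X])

/-- The leading coefficient. -/
noncomputable def ZT.lc (a : ZT) : ℤ := Polynomial.leadingCoeff (R := ℤ) a

theorem ZT.lc_eq_zero {a : ZT} : a.lc = 0 ↔ a = 0 :=
  Polynomial.leadingCoeff_eq_zero (R := ℤ) (p := a)

theorem ZT.lc_neg (a : ZT) : (-a).lc = -a.lc :=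
  Polynomial.leadingCoeff_neg (R := ℤ) a

theorem leadingCoeff_add_nonneg (a b : ℤ[X]) (ha : 0 ≤ a.leadingCoeff)
    (hb : 0 ≤ b.leadingCoeff) : 0 ≤ (a + b).leadingCoeff := by
  rcases lt_trichotomy a.degree b.degree with h | h | h
  · rwa [leadingCoeff_add_of_degree_lt h]
  · by_cases h0 : a.leadingCoeff + b.leadingCoeff = 0
    · have h1 : a.leadingCoeff = 0 := by omega
      have h2 : b.leadingCoeff = 0 := by omega
      rw [leadingCoeff_eq_zero] at h1 h2
      simp [h1, h2]
    · rw [leadingCoeff_add_of_degree_eq h h0]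
      exact add_nonneg ha hb
  · rwa [leadingCoeff_add_of_degree_lt' h]

theorem leadingCoeff_sub_one_nonneg (a : ℤ[X]) (ha : 0 ≤ a.leadingCoeff) (h0 : a ≠ 0) :
    0 ≤ (a - 1).leadingCoeff := by
  rcases lt_or_ge 0 a.degree with hd | hd
  · rwa [leadingCoeff_sub_of_degree_lt (by simpa using hd)]
  · obtain ⟨n, rfl⟩ : ∃ n : ℤ, a = C n := ⟨_, eq_C_of_degree_le_zero hd⟩
    have hn : n ≠ 0 := fun h => h0 (by rw [h, C_0])
    rw [leadingCoeff_C] at ha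
    rw [← C_1, ← C_sub, leadingCoeff_C]
    omega

theorem ZT.lc_add_nonneg {a b : ZT} (ha : 0 ≤ a.lc) (hb : 0 ≤ b.lc) : 0 ≤ (a + b).lc :=
  leadingCoeff_add_nonneg a b ha hb

noncomputable instance : LinearOrder ZT where
  le a b := 0 ≤ (b - a).lc
  le_refl a := by
    have : (a - a).lc = 0 := ZT.lc_eq_zero.2 (sub_self a)
    exact this.ge
  le_trans a b c hab hbc := by
    have h := ZT.lc_add_nonneg hbc hab
    rwa [sub_add_sub_cancel] at h
  le_antisymm a b hab hba := by
    have h : (b - a).lc = -(a - b).lc := by rw [← ZT.lc_neg, neg_sub]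
    have h0 : (a - b).lc = 0 := by
      change 0 ≤ (b - a).lc at hab
      change 0 ≤ (a - b).lc at hba
      omega
    exact sub_eq_zero.1 (ZT.lc_eq_zero.1 h0)
  le_total a b := by
    have h : (b - a).lc = -(a - b).lc := by rw [← ZT.lc_neg, neg_sub]
    change 0 ≤ (b - a).lc ∨ 0 ≤ (a - b).lc
    omega
  toDecidableLE := Classical.decRel _

theorem ZT.le_def {a b : ZT} : a ≤ b ↔ 0 ≤ (b - a).lc := Iff.rfl

instance : IsOrderedAddMonoid ZT where
  add_le_add_left a b h c := by
    rw [ZT.le_def] at h ⊢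
    rwa [add_sub_add_right_eq_sub]

/-- The order is discrete: `1` is the least positive element. -/
theorem ZT.pos_iff {a : ZT} : 0 < a ↔ 1 ≤ a := by
  have h01 : (0 : ZT) < 1 := by
    refine lt_of_le_of_ne ?_ ?_
    · rw [ZT.le_def, sub_zero]
      change 0 ≤ Polynomial.leadingCoeff (1 : ℤ[X])
      simp
    · exact (zero_ne_one : (0 : ℤ[X]) ≠ 1)
  refine ⟨fun h => ?_, fun h => lt_of_lt_of_le h01 h⟩
  have hle : 0 ≤ a.lc := by
    have := ZT.le_def.1 h.le
    rwa [sub_zero] at this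
  exact leadingCoeff_sub_one_nonneg a hle h.ne'

/-- A closed `ℤ[t]`-word over the alphabet `Γ`, in its standard representation
`[1, len] → Γ` with `0 ≤ len`: a partial map on `ℤ[t]` with domain `[1, len]`. -/
@[ext]
structure Word (Γ : Type*) where
  len : ZT
  len_nonneg : 0 ≤ len
  letter : ZT → Option Γ
  isSome_iff : ∀ β, (letter β).isSome ↔ 1 ≤ β ∧ β ≤ len

namespace Word

variable {Γ : Type*}

theorem letter_eq_none (x : Word Γ) {β : ZT} (h : ¬ (1 ≤ β ∧ β ≤ x.len)) : x.letter β = none := by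
  rw [← x.isSome_iff] at h
  simpa using h

theorem ext_letter {x y : Word Γ} (hlen : x.len = y.len)
    (h : ∀ β, 1 ≤ β → β ≤ x.len → x.letter β = y.letter β) : x = y := by
  refine Word.ext hlen (funext fun β => ?_)
  by_cases hβ : 1 ≤ β ∧ β ≤ x.len
  · exact h β hβ.1 hβ.2
  · rw [x.letter_eq_none hβ, y.letter_eq_none (hlen ▸ hβ)]

/-- The empty word. -/
noncomputable instance : One (Word Γ) where
  one :=
    { len := 0
      len_nonneg := le_rfl
      letter := fun _ => none
      isSome_iff := fun β => by
        have h : (0 : ZT) < 1 := ZT.pos_iff.2 le_rfl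
        simpa using fun h1 : 1 ≤ β => lt_of_lt_of_le h h1 }

/-- Concatenation. -/
noncomputable instance : Mul (Word Γ) where
  mul x y :=
    { len := x.len + y.len
      len_nonneg := add_nonneg x.len_nonneg y.len_nonneg
      letter := fun β => if β ≤ x.len then x.letter β else y.letter (β - x.len)
      isSome_iff := fun β => by
        split_ifs with h
        · rw [x.isSome_iff]
          exact ⟨fun k => ⟨k.1, k.2.trans (le_add_of_nonneg_right y.len_nonneg)⟩,
            fun k => ⟨k.1, h⟩⟩
        · rw [y.isSome_iff, sub_le_iff_le_add']
          have h1 : 1 ≤ β - x.len := ZT.pos_iff.1 (sub_pos.2 (not_le.1 h))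
          have h2 : 1 ≤ β :=
            h1.trans (sub_le_self β x.len_nonneg)
          tauto }

@[simp] theorem len_one : (1 : Word Γ).len = 0 := rfl

@[simp] theorem len_mul (x y : Word Γ) : (x * y).len = x.len + y.len := rfl

theorem letter_mul (x y : Word Γ) (β : ZT) :
    (x * y).letter β = if β ≤ x.len then x.letter β else y.letter (β - x.len) := rfl

noncomputable instance : Monoid (Word Γ) where
  one_mul x := by
    refine ext_letter (by simp) fun β h1 _ => ?_
    have h : ¬ β ≤ (1 : Word Γ).len := not_le.2 (ZT.pos_iff.2 h1)
    rw [letter_mul, if_neg h, len_one, sub_zero]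
  mul_one x := by
    refine ext_letter (by simp) fun β _ h2 => ?_
    rw [letter_mul, if_pos (by simpa using h2)]
  mul_assoc x y z := by
    refine ext_letter (by simp [add_assoc]) fun β _ _ => ?_
    simp only [letter_mul, len_mul]
    by_cases h1 : β ≤ x.len
    · rw [if_pos (h1.trans (le_add_of_nonneg_right y.len_nonneg)), if_pos h1, if_pos h1]
    · rw [if_neg h1, if_neg h1]
      by_cases h2 : β ≤ x.len + y.len
      · rw [if_pos h2, if_pos (sub_le_iff_le_add'.2 h2)]
      · rw [if_neg h2, if_neg (fun h => h2 (sub_le_iff_le_add'.1 h)), sub_sub]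

/-- The one-letter word. -/
noncomputable def single (a : Γ) : Word Γ where
  len := 1
  len_nonneg := (ZT.pos_iff.2 le_rfl).le
  letter := fun β => if β = 1 then some a else none
  isSome_iff := fun β => by
    split_ifs with h
    · simp [h]
    · simpa using fun h1 : 1 ≤ β => lt_of_le_of_ne h1 (Ne.symm h)

/-- The finite word with a given list of letters. -/
noncomputable def ofList (l : List Γ) : Word Γ := (l.map single).prod

/-- The involution `x ↦ x̄`: read the word from right to left and invert each letter. -/
noncomputable def bar [Inv Γ] (x : Word Γ) : Word Γ where
  len := x.len
  len_nonneg := x.len_nonneg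
  letter := fun β => (x.letter (x.len + 1 - β)).map fun a => a⁻¹
  isSome_iff := fun β => by
    rw [Option.isSome_map, x.isSome_iff, le_sub_comm, add_sub_cancel_right, sub_le_comm,
      add_sub_cancel_left]
    exact and_comm

theorem bar_bar [InvolutiveInv Γ] (x : Word Γ) : x.bar.bar = x := by
  refine ext_letter rfl fun β _ _ => ?_
  have h : x.len + 1 - (x.len + 1 - β) = β := sub_sub_cancel _ _
  simp only [bar, h, Option.map_map]
  cases x.letter β <;> simp

theorem bar_one [Inv Γ] : (1 : Word Γ).bar = 1 :=
  ext_letter rfl fun _ _ _ => rfl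

theorem bar_single [Inv Γ] (a : Γ) : (single a).bar = single a⁻¹ := by
  refine ext_letter rfl fun β h1 h2 => ?_
  have h : β = 1 := le_antisymm h2 h1
  subst h
  simp [bar, single]

theorem bar_mul [Inv Γ] (x y : Word Γ) : (x * y).bar = y.bar * x.bar := by
  refine ext_letter (add_comm _ _) fun β _ _ => ?_
  change (((x * y).letter (x.len + y.len + 1 - β)).map fun a => a⁻¹) =
    if β ≤ y.len then (y.letter (y.len + 1 - β)).map fun a => a⁻¹
    else (x.letter (x.len + 1 - (β - y.len))).map fun a => a⁻¹
  rw [letter_mul]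
  by_cases h : β ≤ y.len
  · have h' : ¬ x.len + y.len + 1 - β ≤ x.len := by
      rw [not_le, ← sub_pos]
      have e : x.len + y.len + 1 - β - x.len = (y.len - β) + 1 := by ring
      rw [e]
      exact add_pos_of_nonneg_of_pos (sub_nonneg.2 h) (ZT.pos_iff.2 le_rfl)
    rw [if_neg h', if_pos h]
    congr 2
    ring
  · have h' : x.len + y.len + 1 - β ≤ x.len := by
      have h1 : 1 ≤ β - y.len := ZT.pos_iff.1 (sub_pos.2 (not_le.1 h))
      rw [← sub_nonneg] at h1 ⊢
      have e : x.len - (x.len + y.len + 1 - β) = β - y.len - 1 := by ring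
      rwa [e]
    rw [if_pos h', if_neg h]
    congr 2
    ring

theorem bar_ofList [Inv Γ] (l : List Γ) :
    (ofList l).bar = ofList (l.map fun a => a⁻¹).reverse := by
  induction l with
  | nil => exact bar_one
  | cons a l ih =>
    have h1 : ofList (a :: l) = single a * ofList l := by simp [ofList]
    rw [h1, bar_mul, ih, bar_single]
    simp [ofList]

/-- A nonempty word is primitive if it occurs in `w w` only as prefix and as suffix, and
`w̄` does not occur in `w w` at all. -/
def Primitive [Inv Γ] (w : Word Γ) : Prop :=
  w ≠ 1 ∧ (∀ p q : Word Γ, w * w = p * w * q → p = 1 ∨ q = 1) ∧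
    ∀ p q : Word Γ, w * w ≠ p * w.bar * q

end Word

variable {G : Type*} [Group G]

/-- The alphabet `Γ = Σ ∪ Σ⁻¹`, a subset of the group `G`. -/
def Letters (S : Set G) : Type _ := {g : G // g ∈ S ∨ g⁻¹ ∈ S}

instance (S : Set G) : InvolutiveInv (Letters S) where
  inv a := ⟨a.1⁻¹, by rw [inv_inv]; exact a.2.symm⟩
  inv_inv a := Subtype.ext (inv_inv a.1)

/-- The value `π(l) ∈ G` of a finite word over `Γ`. -/
def eval (S : Set G) (l : List (Letters S)) : G := (l.map fun a => a.1).prod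

theorem eval_reverse_inv (S : Set G) (l : List (Letters S)) :
    eval S (l.map fun a => a⁻¹).reverse = (eval S l)⁻¹ := by
  induction l with
  | nil => simp [eval]
  | cons a l ih =>
    simp only [eval, List.map_cons, List.reverse_cons, List.map_append, List.prod_append,
      List.prod_cons, mul_inv_rev, List.map_nil, List.prod_nil, mul_one] at ih ⊢
    rw [ih]
    rfl

/-- `x` is `G`-reduced: no nonempty finite factor of `x` represents `1` in `G`. -/
def GReduced {S : Set G} (x : Word (Letters S)) : Prop :=
  ∀ (p q : Word (Letters S)) (l : List (Letters S)),
    x = p * Word.ofList l * q → l ≠ [] → eval S l ≠ 1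

/-- `x` is cyclically `G`-reduced: all powers `x ^ k` are `G`-reduced. -/
def CyclicallyGReduced {S : Set G} (x : Word (Letters S)) : Prop :=
  ∀ k : ℕ, GReduced (x ^ k)

theorem GReduced.bar {S : Set G} {x : Word (Letters S)} (h : GReduced x) : GReduced x.bar := by
  intro p q l e hl h1
  refine h q.bar p.bar (l.map fun a => a⁻¹).reverse ?_ (by simpa using hl) ?_
  · rw [← Word.bar_bar x, e, Word.bar_mul, Word.bar_mul, Word.bar_ofList, mul_assoc]
  · rw [eval_reverse_inv, h1, inv_one]

/-- The defining relations `u ℓ r̄ ū = 1` of the monoid `M(A,G)`, where `u` is `G`-reduced and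
`ℓ`, `r` are finite words with `π(ℓ) = π(r)`. -/
def Rel (S : Set G) (x y : Word (Letters S)) : Prop :=
  ∃ (u : Word (Letters S)) (l r : List (Letters S)), GReduced u ∧ eval S l = eval S r ∧
    x = u * Word.ofList l * (Word.ofList r).bar * u.bar ∧ y = 1

/-- The congruence on the monoid of words generated by the defining relations. -/
noncomputable def relCon (S : Set G) : Con (Word (Letters S)) := conGen (Rel S)

/-- The monoid `M(A,G)`. -/
abbrev MonM (S : Set G) : Type _ := (relCon S).Quotient

/-- The canonical epimorphism from words onto `M(A,G)`. -/
noncomputable def toM (S : Set G) : Word (Letters S) →* MonM S := (relCon S).mk'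

/-- `Ext(A,G)`: the image in `M(A,G)` of the submonoid `R*(A,G)` of the monoid of words which is
generated by the `G`-reduced words. -/
noncomputable def Ext (S : Set G) : Submonoid (MonM S) :=
  (Submonoid.closure {u : Word (Letters S) | GReduced u}).map (toM S)

theorem toM_mul_bar {S : Set G} {u : Word (Letters S)} (hu : GReduced u) :
    toM S u * toM S u.bar = 1 := by
  rw [← map_mul, ← map_one (toM S)]
  refine (Con.eq _).2 (ConGen.Rel.of _ _ ⟨u, [], [], hu, rfl, ?_, rfl⟩)
  have h : Word.ofList ([] : List (Letters S)) = 1 := rfl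
  rw [h, Word.bar_one, mul_one, mul_one]

theorem toM_bar_mul {S : Set G} {u : Word (Letters S)} (hu : GReduced u) :
    toM S u.bar * toM S u = 1 := by
  have h := toM_mul_bar hu.bar
  rwa [Word.bar_bar] at h

theorem toM_mem_Ext {S : Set G} {u : Word (Letters S)} (hu : GReduced u) : toM S u ∈ Ext S :=
  Submonoid.mem_map_of_mem _ (Submonoid.subset_closure hu)

theorem Ext.isUnit {S : Set G} (a : Ext S) : IsUnit a := by
  obtain ⟨_, x, hx, rfl⟩ := a
  change x ∈ Submonoid.closure {u : Word (Letters S) | GReduced u} at hx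
  have key : ∀ h : toM S x ∈ Ext S, IsUnit (⟨toM S x, h⟩ : Ext S) := by
    induction hx using Submonoid.closure_induction with
    | mem u hu =>
      exact fun h => ⟨⟨⟨toM S u, h⟩, ⟨toM S u.bar, toM_mem_Ext hu.bar⟩,
        Subtype.ext (toM_mul_bar hu), Subtype.ext (toM_bar_mul hu)⟩, rfl⟩
    | one =>
      intro h
      have e : (⟨toM S 1, h⟩ : Ext S) = 1 := Subtype.ext (map_one (toM S))
      rw [e]
      exact isUnit_one
    | mul x y hx hy ihx ihy =>
      intro h
      have mx : toM S x ∈ Ext S := Submonoid.mem_map_of_mem _ hx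
      have my : toM S y ∈ Ext S := Submonoid.mem_map_of_mem _ hy
      have e : (⟨toM S (x * y), h⟩ : Ext S) = ⟨toM S x, mx⟩ * ⟨toM S y, my⟩ :=
        Subtype.ext (map_mul (toM S) x y)
      rw [e]
      exact (ihx mx).mul (ihy my)
  exact key _

/-- `Ext(A,G)` is a group, with the multiplication inherited from `M(A,G)`. -/
noncomputable instance (S : Set G) : Group (Ext S) := groupOfIsUnit Ext.isUnit

end InfWords

namespace InfWords

/-! The stable letter is realised by a single long reduced word s satisfying u s = s v already as
words. Let α be the common length of u, v, w, let B be the convex subgroup generated by α, and let C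
be the polynomials of degree at most d, where d > deg α is so large that every element of H has a
representative with length in C. The word s has length T = t^(d+1). On positions in B it repeats u,
on the coset T + B it repeats v, and on every other coset of B it repeats w, except for sparse
marked cosets near 2^k τ and T - 2^k τ (with τ = t^d), where it repeats the inverse of w. Finite
factors stay inside one coset, so s is reduced (`Scale.word_reduced`). Period α on every coset gives
u s = s v (`Scale.word_comm`). The sparse marks and the primitivity of w make s rigid: an agreement
of s or s̄ with a translate of s or s̄ at all large positions in C is only possible with equal
orientations and a translation in ℤα (`Scale.shift_same`, `Scale.not_shift`).

Injectivity is then Britton's lemma, proved on words. A word that is trivial in M(A,G) arises from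
the empty word by inserting relators u f ū, with u reduced and f finite of value 1 (`null_of_toM`).
A reduced HNN expression of positive s-length is represented by a word g₀ s^±1 g₁ ⋯ s^±1 gₙ whose gᵢ
have length in C. Suppose it contains a relator u f ū with |u| outside C. The centre is not near an
end of the word, and it is not deep inside an occurrence of s, which is reduced. So it sits at the
junction of two occurrences, where u f ū folds the end of one onto the beginning of the next.
Rigidity makes their signs opposite and the element between them a power of u or of v, which is a
pinch (`Junction.relator_mem`). Hence every relator that occurs is short, and deleting it preserves
the shape of the word (`Form.delete`), so the empty word is never reached (`Form.not_null`). -/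

theorem ZT.zero_lt_one : (0 : ZT) < 1 := ZT.pos_iff.2 le_rfl

instance : Nontrivial ZT := ⟨0, 1, ZT.zero_lt_one.ne⟩

theorem ZT.lc_mul (a b : ZT) : (a * b).lc = a.lc * b.lc :=
  Polynomial.leadingCoeff_mul (R := ℤ) a b

theorem ZT.pos_iff_lc {a : ZT} : 0 < a ↔ 0 < a.lc := by
  rw [lt_iff_le_and_ne, ZT.le_def, sub_zero, lt_iff_le_and_ne, ne_comm, ne_comm (a := (0 : ℤ)),
    ne_eq, ne_eq, ZT.lc_eq_zero]

instance : ZeroLEOneClass ZT := ⟨ZT.zero_lt_one.le⟩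

instance : IsStrictOrderedRing ZT :=
  IsStrictOrderedRing.of_mul_pos fun a b ha hb => by
    rw [ZT.pos_iff_lc, ZT.lc_mul]
    exact mul_pos (ZT.pos_iff_lc.1 ha) (ZT.pos_iff_lc.1 hb)

/-! ### Splitting of words, Levi's lemma, finite words -/

namespace Word

variable {Γ : Type*}

theorem eq_one_of_len {x : Word Γ} (h : x.len = 0) : x = 1 :=
  ext_letter (by simpa using h) fun β h1 h2 =>
    absurd (h1.trans (h ▸ h2)) (not_le.2 ZT.zero_lt_one)

theorem len_eq_zero {x : Word Γ} : x.len = 0 ↔ x = 1 :=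
  ⟨eq_one_of_len, fun h => by rw [h, len_one]⟩

theorem len_pos {x : Word Γ} (h : x ≠ 1) : 0 < x.len :=
  lt_of_le_of_ne x.len_nonneg fun h0 => h (eq_one_of_len h0.symm)

theorem mul_eq_one_left {x y : Word Γ} (h : x * y = 1) : x = 1 := by
  have h1 : x.len + y.len = 0 := by rw [← len_mul, h, len_one]
  exact eq_one_of_len (by linarith [x.len_nonneg, y.len_nonneg])

theorem mul_eq_one_right {x y : Word Γ} (h : x * y = 1) : y = 1 := by
  rwa [mul_eq_one_left h, one_mul] at h

theorem letter_mul_of_le (x y : Word Γ) {β : ZT} (h : β ≤ x.len) :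
    (x * y).letter β = x.letter β := if_pos h

theorem letter_mul_of_lt (x y : Word Γ) {β : ZT} (h : x.len < β) :
    (x * y).letter β = y.letter (β - x.len) := if_neg (not_le.2 h)

theorem letter_mul_add (x y : Word Γ) {β : ZT} (h : 0 < β) :
    (x * y).letter (β + x.len) = y.letter β := by
  rw [letter_mul_of_lt _ _ (by linarith), add_sub_cancel_right]

theorem mul_inj_of_len {p q p' q' : Word Γ} (h : p * q = p' * q') (hl : p.len = p'.len) :
    p = p' ∧ q = q' := by
  have hq : q.len = q'.len := by
    have := congrArg len h
    simp only [len_mul] at this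
    linarith
  constructor
  · refine ext_letter hl fun β _ h2 => ?_
    rw [← letter_mul_of_le p q h2, h, letter_mul_of_le p' q' (hl ▸ h2)]
  · refine ext_letter hq fun β h1 _ => ?_
    have h0 : 0 < β := ZT.pos_iff.2 h1
    rw [← letter_mul_add p q h0, h, hl, letter_mul_add p' q' h0]

theorem mul_left_inj' {p q q' : Word Γ} (h : p * q = p * q') : q = q' :=
  (mul_inj_of_len h rfl).2

theorem exists_split (x : Word Γ) {κ : ZT} (h0 : 0 ≤ κ) (h1 : κ ≤ x.len) :
    ∃ p q : Word Γ, x = p * q ∧ p.len = κ := by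
  let p : Word Γ :=
    { len := κ
      len_nonneg := h0
      letter := fun β => if β ≤ κ then x.letter β else none
      isSome_iff := fun β => by
        split_ifs with h
        · rw [x.isSome_iff]
          exact ⟨fun k => ⟨k.1, h⟩, fun k => ⟨k.1, h.trans h1⟩⟩
        · simpa using fun _ => not_le.1 h }
  let q : Word Γ :=
    { len := x.len - κ
      len_nonneg := sub_nonneg.2 h1
      letter := fun β => if 1 ≤ β then x.letter (β + κ) else none
      isSome_iff := fun β => by
        split_ifs with h
        · rw [x.isSome_iff]
          constructor <;> intro k <;> constructor <;> linarith [k.1, k.2]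
        · simpa using fun h2 => absurd h2 h }
  refine ⟨p, q, ext_letter ?_ fun β hb _ => ?_, rfl⟩
  · change x.len = κ + (x.len - κ)
    ring
  · rw [letter_mul]
    change x.letter β = if β ≤ κ then (if β ≤ κ then x.letter β else none) else
      if 1 ≤ β - κ then x.letter (β - κ + κ) else none
    split_ifs with h h2
    · rfl
    · rw [sub_add_cancel]
    · exact absurd (ZT.pos_iff.1 (sub_pos.2 (not_le.1 h))) h2

/-- Levi's lemma survives for non-Archimedean lengths, because lengths are totally ordered and
closed words can be cut at any position. -/
theorem levi_of_le {p q p' q' : Word Γ} (h : p * q = p' * q') (hl : p.len ≤ p'.len) :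
    ∃ m, p' = p * m ∧ q = m * q' := by
  obtain ⟨p1, m, rfl, hp⟩ := exists_split p' p.len_nonneg hl
  rw [mul_assoc] at h
  obtain ⟨rfl, rfl⟩ := mul_inj_of_len h hp.symm
  exact ⟨m, rfl, rfl⟩

theorem levi {p q p' q' : Word Γ} (h : p * q = p' * q') :
    (∃ m, p' = p * m ∧ q = m * q') ∨ ∃ m, p = p' * m ∧ q' = m * q := by
  rcases le_total p.len p'.len with hl | hl
  · exact Or.inl (levi_of_le h hl)
  · exact Or.inr (levi_of_le h.symm hl)

@[simp] theorem ofList_nil : ofList ([] : List Γ) = 1 := rfl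

theorem ofList_cons (a : Γ) (l : List Γ) : ofList (a :: l) = single a * ofList l := by
  simp [ofList]

theorem ofList_append (l l' : List Γ) : ofList (l ++ l') = ofList l * ofList l' := by
  simp [ofList]

theorem len_single (a : Γ) : (single a).len = 1 := rfl

theorem len_ofList (l : List Γ) : (ofList l).len = (l.length : ZT) := by
  induction l with
  | nil => simp
  | cons a l ih => rw [ofList_cons, len_mul, ih, len_single, List.length_cons]; push_cast; ring

theorem single_inj {a b : Γ} (h : single a = single b) : a = b := by
  have := congrArg (fun x : Word Γ => x.letter 1) h
  simpa [single] using this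

theorem ofList_inj {l l' : List Γ} (h : ofList l = ofList l') : l = l' := by
  induction l generalizing l' with
  | nil =>
    cases l' with
    | nil => rfl
    | cons b l' =>
      have := congrArg len h
      rw [len_ofList, len_ofList] at this
      exact absurd this (by simpa using (Nat.cast_add_one_ne_zero (R := ZT) l'.length).symm)
  | cons a l ih =>
    cases l' with
    | nil =>
      have := congrArg len h
      rw [len_ofList, len_ofList] at this
      exact absurd this (by simpa using (Nat.cast_add_one_ne_zero (R := ZT) l.length))
    | cons b l' =>
      rw [ofList_cons, ofList_cons] at h
      obtain ⟨h1, h2⟩ := mul_inj_of_len h rfl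
      rw [single_inj h1, ih h2]

theorem ofList_eq_one {l : List Γ} (h : ofList l = 1) : l = [] :=
  ofList_inj (h.trans ofList_nil.symm)

theorem ofList_eq_mul {l : List Γ} {x y : Word Γ} (h : ofList l = x * y) :
    ∃ l₁ l₂, l = l₁ ++ l₂ ∧ x = ofList l₁ ∧ y = ofList l₂ := by
  induction l generalizing x with
  | nil =>
    have h := h.symm
    rw [ofList_nil] at h
    exact ⟨[], [], rfl, mul_eq_one_left h, mul_eq_one_right h⟩
  | cons a l ih =>
    by_cases hx : x = 1
    · exact ⟨[], a :: l, rfl, hx, by rw [h, hx, one_mul]⟩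
    · rw [ofList_cons] at h
      obtain ⟨m, rfl, hm⟩ := levi_of_le h (ZT.pos_iff.1 (len_pos hx))
      obtain ⟨l₁, l₂, rfl, rfl, rfl⟩ := ih hm
      exact ⟨a :: l₁, l₂, rfl, (ofList_cons _ _).symm, rfl⟩

/-- A nonempty word ends with a letter. -/
theorem exists_last {x : Word Γ} (h : x ≠ 1) : ∃ y a, x = y * single a := by
  obtain ⟨y, z, rfl, hy⟩ := exists_split x (κ := x.len - 1)
    (sub_nonneg.2 (ZT.pos_iff.1 (len_pos h))) (by linarith [ZT.zero_lt_one])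
  have hz : z.len = 1 := by rw [len_mul] at hy; linarith
  have hs : (z.letter 1).isSome := (z.isSome_iff 1).2 ⟨le_rfl, hz.ge⟩
  obtain ⟨a, ha⟩ := Option.isSome_iff_exists.1 hs
  refine ⟨y, a, congrArg _ (ext_letter hz fun β h1 h2 => ?_)⟩
  obtain rfl : β = 1 := le_antisymm (h2.trans hz.le) h1
  simp [ha, single]

section bar

variable [InvolutiveInv Γ]

@[simp] theorem len_bar (x : Word Γ) : x.bar.len = x.len := rfl

theorem bar_inj {x y : Word Γ} (h : x.bar = y.bar) : x = y := by
  rw [← bar_bar x, h, bar_bar]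

theorem bar_eq_one {x : Word Γ} : x.bar = 1 ↔ x = 1 := by
  rw [← len_eq_zero, len_bar, len_eq_zero]

theorem bar_pow (x : Word Γ) (k : ℕ) : (x ^ k).bar = x.bar ^ k := by
  induction k with
  | zero => exact bar_one
  | succ k ih => rw [pow_succ, bar_mul, ih, pow_succ']

end bar

end Word

/-! ### Reduced words and relators -/

section reduced

variable {G : Type*} [Group G] {S : Set G}

open Word

@[simp] theorem eval_nil : eval S [] = 1 := rfl

theorem eval_append (l l' : List (Letters S)) : eval S (l ++ l') = eval S l * eval S l' := by
  simp [eval]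

/-- The formal inverse of a finite word. -/
def invList (l : List (Letters S)) : List (Letters S) := (l.map fun a => a⁻¹).reverse

theorem eval_invList (l : List (Letters S)) : eval S (invList l) = (eval S l)⁻¹ :=
  eval_reverse_inv S l

theorem ofList_invList (l : List (Letters S)) : ofList (invList l) = (ofList l).bar :=
  (bar_ofList l).symm

theorem GReduced.left {x y : Word (Letters S)} (h : GReduced (x * y)) : GReduced x :=
  fun p q l e => h p (q * y) l (by rw [e]; simp only [mul_assoc])

theorem GReduced.right {x y : Word (Letters S)} (h : GReduced (x * y)) : GReduced y :=
  fun p q l e => h (x * p) q l (by rw [e]; simp only [mul_assoc])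

theorem GReduced.list_eq_nil {p q : Word (Letters S)} {l : List (Letters S)}
    (h : GReduced (p * ofList l * q)) (hl : eval S l = 1) : l = [] := by
  by_contra h0
  exact h p q l rfl h0 hl

theorem gReduced_one : GReduced (1 : Word (Letters S)) := by
  intro p q l h hl
  have h1 := mul_eq_one_right (mul_eq_one_left h.symm)
  exact absurd (ofList_eq_one h1) hl

/-- The order is discrete, so a nonempty closed word has a last letter a, and a a⁻¹ would be a
finite factor of value 1. -/
theorem GReduced.mul_bar {x : Word (Letters S)} (h : GReduced (x * x.bar)) : x = 1 := by
  by_contra hx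
  obtain ⟨y, a, rfl⟩ := exists_last hx
  refine h y y.bar [a, a⁻¹] ?_ (by simp) ?_
  · rw [bar_mul, bar_single, ofList_cons, ofList_cons, ofList_nil, mul_one]
    simp only [mul_assoc]
  · exact (by simp [eval]; exact mul_inv_cancel a.1)

/-- A relator `u f ū` with `u` reduced and `f` finite of trivial value. -/
def IsRelator (x : Word (Letters S)) : Prop :=
  ∃ (u : Word (Letters S)) (f : List (Letters S)), GReduced u ∧ eval S f = 1 ∧
    x = u * ofList f * u.bar

theorem IsRelator.bar {x : Word (Letters S)} (h : IsRelator x) : IsRelator x.bar := by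
  obtain ⟨u, f, hu, hf, rfl⟩ := h
  refine ⟨u, invList f, hu, by rw [eval_invList, hf, inv_one], ?_⟩
  rw [bar_mul, bar_mul, bar_bar, ofList_invList, mul_assoc]

theorem IsRelator.eq_one {x : Word (Letters S)} (h : IsRelator x) (hx : GReduced x) : x = 1 := by
  obtain ⟨u, f, hu, hf, rfl⟩ := h
  obtain rfl := hx.list_eq_nil hf
  rw [ofList_nil, mul_one] at hx ⊢
  rw [hx.mul_bar, one_mul, bar_one]

end reduced

/-! ### Words that are trivial in M(A,G) -/

section null

variable {G : Type*} [Group G] {S : Set G}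

open Word

/-- The words which can be obtained from the empty word by inserting relators. -/
inductive Null : Word (Letters S) → Prop
  | one : Null 1
  | ins (p q u : Word (Letters S)) (f : List (Letters S)) : Null (p * q) → GReduced u →
      eval S f = 1 → Null (p * (u * ofList f * u.bar) * q)

theorem Null.insert {x y : Word (Letters S)} (p q u : Word (Letters S)) (f : List (Letters S))
    (hy : Null y) (e : y = p * q) (hu : GReduced u) (hf : eval S f = 1)
    (e' : x = p * (u * ofList f * u.bar) * q) : Null x := by
  subst e e'
  exact Null.ins p q u f hy hu hf

theorem Null.bar {x : Word (Letters S)} (h : Null x) : Null x.bar := by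
  induction h with
  | one => rw [bar_one]; exact Null.one
  | ins p q u f _ hu hf ih =>
    refine ih.insert q.bar p.bar u (invList f) (bar_mul _ _) hu (by rw [eval_invList, hf, inv_one]) ?_
    simp only [bar_mul, bar_bar, ofList_invList, mul_assoc]

/-- The case of `Null.change` in which the replaced factor l begins to the left of the relator
inserted last. If l swallows the relator, the relator is removed from l. If l ends inside it, the
overlap is moved into the replacement and what is left of the relator is inserted afterwards. -/
theorem Null.change_left {p l q r y v g Q}
    (ih : ∀ (p' : Word (Letters S)) l' q' r', p * y * Q = p' * ofList l' * q' →
      eval S l' = eval S r' → Null (p' * ofList r' * q'))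
    (hv : GReduced v) (hg : eval S g = 1)
    (h : ofList l * q = y * ((v * ofList g * v.bar) * Q)) (hlr : eval S l = eval S r) :
    Null (p * ofList r * q) := by
  rcases levi h with ⟨m, rfl, rfl⟩ | ⟨m, h1, h2⟩
  · refine (ih p l (m * Q) r (by simp only [mul_assoc]) hlr).insert (p * ofList r * m) Q v g ?_ hv hg ?_ <;>
      simp only [mul_assoc]
  obtain ⟨l₁, l₂, rfl, rfl, rfl⟩ := ofList_eq_mul h1
  rw [eval_append] at hlr
  rcases levi h2 with ⟨m, h3, rfl⟩ | ⟨m, h3, rfl⟩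
  · obtain ⟨e, k, rfl, h4, rfl⟩ := ofList_eq_mul h3
    obtain ⟨e₁, e₂, rfl, h5, h6⟩ := ofList_eq_mul h4.symm
    obtain ⟨e₃, e₄, rfl, rfl, h7⟩ := ofList_eq_mul h5.symm
    rw [← ofList_invList] at h6
    obtain rfl := ofList_inj h6
    obtain rfl := ofList_inj h7
    refine ih p (l₁ ++ k) q r (by simp only [mul_assoc, ofList_append]) ?_
    simpa [eval_append, eval_invList, hg] using hlr
  · rw [mul_assoc] at h3
    rcases levi h3 with ⟨k, h4, _⟩ | ⟨k, rfl, rfl⟩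
    · obtain ⟨v₁, k, rfl, rfl, rfl⟩ := ofList_eq_mul h4
      rw [← ofList_invList, ← ofList_append, ← ofList_append] at h3
      obtain ⟨a, m', h5, h6, rfl⟩ := ofList_eq_mul h3
      obtain rfl := ofList_inj h6
      have h7 := congrArg (eval S) h5
      simp only [eval_append, eval_invList, hg, one_mul, mul_inv_cancel] at h7 hlr
      refine (ih p l₁ Q (r ++ m') rfl ?_) |> fun h => by simpa only [ofList_append, mul_assoc] using h
      rw [eval_append, ← hlr, mul_assoc, ← h7, mul_one]
    · have h5 := ih p l₁ Q (r ++ invList l₂) rfl (by rw [eval_append, eval_invList, ← hlr]; simp)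
      refine h5.insert (p * ofList r) (ofList (invList l₂) * Q) k g ?_ hv.right hg ?_ <;>
        simp only [ofList_append, mul_assoc, bar_mul, ofList_invList]

/-- The case of `Null.change` in which l lies inside the relator v g v̄. If l meets g, then v g v̄
with l replaced by r is again a relator, up to moving a finite end of v into its centre. If l lies
inside v or v̄, the result is obtained by inserting two nested relators. -/
theorem Null.change_mid {P Q y l y₂ v g} {r : List (Letters S)} (hN : Null (P * Q))
    (hv : GReduced v) (hg : eval S g = 1)
    (h : v * ofList g * v.bar = y * ofList l * y₂) (hlr : eval S l = eval S r) :
    Null (P * y * ofList r * y₂ * Q) := by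
  rw [mul_assoc, mul_assoc] at h
  rcases levi h with ⟨m, rfl, h1⟩ | ⟨m, rfl, h1⟩
  · rcases levi h1 with ⟨n, rfl, h3⟩ | ⟨n, h2, h3⟩
    · have h4 : v = y₂.bar * ofList (invList l) * n.bar := by
        rw [← bar_bar v, h3, ofList_invList]
        simp only [bar_mul, mul_assoc]
      have h5 : GReduced y₂.bar := by rw [h4] at hv; exact hv.left.left
      have h6 : GReduced n.bar := by rw [h4] at hv; exact hv.right
      have h7 := Null.ins P Q y₂.bar (invList l ++ r) hN h5
        (by rw [eval_append, eval_invList, hlr, inv_mul_cancel])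
      refine h7.insert (P * y₂.bar * ofList (invList l)) (ofList r * y₂ * Q) n.bar g ?_ h6 hg ?_
      · simp only [ofList_append, bar_bar, mul_assoc]
      · simp only [h4, bar_bar, mul_assoc]
    · obtain ⟨m, n, rfl, rfl, rfl⟩ := ofList_eq_mul h2
      rw [eval_append] at hg
      rcases levi h3 with ⟨k, h4, rfl⟩ | ⟨k, h4, h5⟩
      · obtain ⟨a, k, rfl, h6, rfl⟩ := ofList_eq_mul h4
        obtain rfl := ofList_inj h6
        rw [eval_append] at hg
        refine hN.insert P Q v (m ++ r ++ k) rfl hv ?_ ?_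
        · rw [eval_append, eval_append, ← hlr, mul_assoc, hg]
        · simp only [ofList_append, mul_assoc]
      · obtain ⟨a, k, rfl, h6, rfl⟩ := ofList_eq_mul h4
        obtain rfl := ofList_inj h6
        have h7 : v = y₂.bar * ofList (invList k) := by
          rw [← bar_bar v, h5, bar_mul, ofList_invList]
        rw [h7] at hv ⊢
        refine hN.insert P Q y₂.bar (invList k ++ m ++ r) rfl hv.left ?_ ?_
        · rw [eval_append, eval_append, eval_invList, ← hlr, eval_append, mul_assoc,
            ← mul_assoc (eval S m), hg, one_mul, inv_mul_cancel]
        · simp only [ofList_append, bar_bar, mul_assoc]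
  · rcases levi h1 with ⟨n, rfl, rfl⟩ | ⟨n, h2, h3⟩
    · refine (Null.ins P Q y (r ++ invList l) hN hv.left
        (by rw [eval_append, eval_invList, hlr, mul_inv_cancel])).insert
        (P * y * ofList r) (ofList (invList l) * y.bar * Q) n g ?_ hv.right.right hg ?_ <;>
        simp only [ofList_append, mul_assoc, bar_mul, ofList_invList]
    · obtain ⟨m, n, rfl, rfl, rfl⟩ := ofList_eq_mul h2
      rw [bar_mul, ← ofList_invList, ← mul_assoc, ← ofList_append] at h3
      rw [eval_append] at hlr
      rcases levi h3 with ⟨k, h4, h5⟩ | ⟨k, h4, rfl⟩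
      · obtain ⟨a, k, rfl, h6, rfl⟩ := ofList_eq_mul h4
        obtain rfl := ofList_inj h6
        rw [eval_append, eval_append, eval_invList, hg] at hlr
        have h7 : y = y₂.bar * ofList (invList k) := by
          rw [← bar_bar y, h5, bar_mul, ofList_invList]
        rw [h7] at hv ⊢
        refine hN.insert P Q y₂.bar (invList k ++ r) rfl hv.left.left ?_ ?_
        · rw [eval_append, eval_invList, ← hlr]
          simp
        · simp only [ofList_append, bar_bar, mul_assoc]
      · obtain ⟨a, k, h5, h6, rfl⟩ := ofList_eq_mul h4
        obtain rfl := ofList_inj h6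
        have h7 := congrArg (eval S) h5
        rw [eval_append, eval_append, eval_invList, hg, one_mul] at h7
        refine hN.insert P Q y (r ++ k) rfl hv.left ?_ ?_
        · rw [eval_append, ← hlr, mul_assoc, ← h7, mul_inv_cancel]
        · simp only [ofList_append, mul_assoc]

theorem Null.change {x : Word (Letters S)} (h : Null x) : ∀ (p : Word (Letters S)) l q r,
    x = p * ofList l * q → eval S l = eval S r → Null (p * ofList r * q) := by
  induction h with
  | one =>
    intro p l q r h hlr
    obtain rfl := mul_eq_one_right h.symm
    rw [mul_one] at h ⊢
    obtain rfl := mul_eq_one_left h.symm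
    rw [one_mul] at h ⊢
    obtain rfl := ofList_eq_one h.symm
    simpa [bar_one] using Null.one.insert 1 1 1 r (one_mul 1).symm gReduced_one hlr.symm rfl
  | ins P Q v g hN hv hg ih =>
    intro p l q r h hlr
    simp only [mul_assoc] at h
    rcases levi h with ⟨y, rfl, h1⟩ | ⟨y, rfl, h1⟩
    · rcases levi (p := v * ofList g * v.bar) (q := Q) (p' := y * ofList l) (q' := q)
        (by simpa only [mul_assoc] using h1) with ⟨k, h2, rfl⟩ | ⟨k, h2, rfl⟩
      -- Here l sticks out of the relator on the right; the involution reduces this to the case of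
      -- sticking out on the left.
      · have := Null.change_left (p := q.bar) (l := invList l) (q := (P * y).bar) (r := invList r)
          (y := k.bar) (v := v) (g := invList g) (Q := P.bar) ?_ hv
          (by rw [eval_invList, hg, inv_one]) ?_ (by rw [eval_invList, eval_invList, hlr])
        · have := this.bar
          simpa only [bar_mul, ofList_invList, bar_bar, mul_assoc] using this
        · intro p' l' q' r' h3 h4
          have h5 := (ih q'.bar (invList l') p'.bar (invList r') ?_
            (by rw [eval_invList, eval_invList, h4])).bar
          · simpa only [bar_mul, ofList_invList, bar_bar, mul_assoc] using h5
          · apply bar_inj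
            simpa only [bar_mul, ofList_invList, bar_bar, mul_assoc] using h3
        · apply bar_inj
          simp only [bar_mul, ofList_invList, bar_bar, mul_assoc] at h2 ⊢
          rw [h2]
      · have := hN.change_mid hv hg h2 hlr
        simpa only [mul_assoc] using this
    · exact Null.change_left ih hv hg (by simpa only [mul_assoc] using h1) hlr

/-- The cut between u and ū lies to the left of the relator. The part of ū before the relator
cancels by induction (`key`), and the remaining overlap m of ū with the relator is handled by
modifying the relator. -/
theorem Null.cancel_left {p u y q v g Q} (hN : Null (p * u * y * Q))
    (ih : ∀ p' u' q' : Word (Letters S), p * u * y * Q = p' * u' * u'.bar * q' → GReduced u' →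
      Null (p' * q'))
    (hu : GReduced u) (hv : GReduced v) (hg : eval S g = 1)
    (h : u.bar * q = y * ((v * ofList g * v.bar) * Q)) : Null (p * q) := by
  rcases levi h with ⟨m, rfl, rfl⟩ | ⟨m, hm, h1⟩
  · refine (ih p u (m * Q) (by simp only [mul_assoc]) hu).insert (p * m) Q v g ?_ hv hg ?_ <;>
      simp only [mul_assoc]
  have hum : u = m.bar * y.bar := by rw [← bar_bar u, hm, bar_mul]
  have hm' : GReduced m := by
    have := hu.bar
    rw [hm] at this
    exact this.right
  have key : Null (p * m.bar * Q) := by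
    refine ih (p * m.bar) y.bar Q ?_ ?_
    · rw [hum]; simp only [mul_assoc, bar_bar]
    · rw [hum] at hu; exact hu.right
  simp only [mul_assoc] at h1
  rcases levi h1 with ⟨k, rfl, h2⟩ | ⟨k, rfl, rfl⟩
  · rcases levi h2 with ⟨n, rfl, h3⟩ | ⟨n, h3, rfl⟩
    · obtain rfl : g = [] := by
        rw [← mul_assoc] at hm'
        exact hm'.list_eq_nil hg
      simp only [ofList_nil, one_mul] at *
      rcases levi h3 with ⟨z, rfl, rfl⟩ | ⟨z, h4, rfl⟩
      · rw [← mul_assoc] at hm'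
        obtain rfl := hm'.left.mul_bar
        refine ih p u q ?_ hu
        simp only [hm, bar_one, one_mul, mul_assoc]
      · have h5 : v = z.bar * n.bar := by rw [← bar_bar v, h4, bar_mul]
        rw [h5, mul_assoc] at hm'
        have h6 := hm'.right
        have h7 := GReduced.mul_bar (x := n.bar) (by rwa [bar_bar])
        rw [bar_eq_one] at h7
        subst h7
        rw [one_mul] at h3
        rw [← h3]
        simpa only [mul_one, mul_assoc] using key
    · obtain ⟨k, n, rfl, rfl, rfl⟩ := ofList_eq_mul h3
      rw [eval_append] at hg
      have := key.change p (invList k) (v.bar * Q) n (by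
        simp only [bar_mul, ofList_invList, mul_assoc])
        (by rw [eval_invList]; exact (eq_inv_of_mul_eq_one_right hg).symm)
      simpa only [mul_assoc] using this
  · refine key.insert (p) (m.bar * Q) k g (by simp only [mul_assoc]) hv.right hg ?_
    simp only [mul_assoc, bar_mul]

/-- The cut lies in the finite centre g₁ g₂ of the relator and u does not reach beyond g₁, so u is
finite and its removal only shortens the centre, possibly after moving a finite end of v into it. -/
theorem Null.cancel_center_left {P v Q : Word (Letters S)} {g₁ g₂ : List (Letters S)} {p u q m}
    (hN : Null (P * Q)) (hv : GReduced v) (hg : eval S (g₁ ++ g₂) = 1) (hm : ofList g₁ = m * u)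
    (hp : p = P * v * m) (h : u.bar * q = ofList g₂ * (v.bar * Q)) : Null (p * q) := by
  obtain ⟨m, u, rfl, rfl, rfl⟩ := ofList_eq_mul hm
  subst hp
  rw [← ofList_invList] at h
  simp only [eval_append] at hg
  rcases levi h with ⟨n, h1, rfl⟩ | ⟨n, h1, h2⟩
  · obtain ⟨a, n, rfl, h2, rfl⟩ := ofList_eq_mul h1
    obtain rfl := ofList_inj h2
    refine hN.insert P Q v (m ++ n) rfl hv ?_ (by simp only [ofList_append, mul_assoc])
    simpa [eval_append, eval_invList, mul_assoc] using hg
  · obtain ⟨a, n, h3, h2', rfl⟩ := ofList_eq_mul h1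
    obtain rfl := ofList_inj h2'
    have h4 : eval S m = eval S n := by
      have h5 := congrArg (eval S) h3
      rw [eval_invList, eval_append] at h5
      rw [← inv_inv (eval S u), h5] at hg
      simpa [mul_assoc, mul_inv_eq_one] using hg
    rcases levi h2 with ⟨k, h5, rfl⟩ | ⟨k, h5, rfl⟩
    · obtain ⟨v₁, k, rfl, h6, rfl⟩ := ofList_eq_mul h5
      have hve : v = ofList (invList v₁) := by rw [ofList_invList, ← h6, bar_bar]
      have := hN.change P k q (invList v₁ ++ m) (by rw [mul_assoc]) (by
        rw [eval_append, h4, eval_append, eval_invList, inv_mul_cancel_left])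
      simpa only [hve, ofList_append, mul_assoc] using this
    · have hve : v = k.bar * (ofList (invList n)) := by
        rw [← bar_bar v, h5, bar_mul, ofList_invList]
      rw [hve] at hv ⊢
      refine hN.insert P Q k.bar (invList n ++ m) rfl hv.left ?_ ?_
      · rw [eval_append, eval_invList, h4, inv_mul_cancel]
      · simp only [bar_bar, ofList_append, mul_assoc]

theorem Null.cancel_center {P v Q p u q : Word (Letters S)} {g₁ g₂ : List (Letters S)}
    (hN : Null (P * Q))
    (ih : ∀ p' u' q' : Word (Letters S), P * Q = p' * u' * u'.bar * q' → GReduced u' →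
      Null (p' * q'))
    (hu : GReduced u) (hv : GReduced v) (hg : eval S (g₁ ++ g₂) = 1)
    (h₁ : p * u = P * v * ofList g₁) (h₂ : u.bar * q = ofList g₂ * (v.bar * Q)) :
    Null (p * q) := by
  rcases levi h₁ with ⟨m, h3, h4⟩ | ⟨m, h3, h4⟩
  swap
  · exact hN.cancel_center_left hv hg h4 h3 h₂
  rcases levi h₂ with ⟨n, h5, h6⟩ | ⟨n, h5, h6⟩
  · have := Null.cancel_center_left (P := Q.bar) (v := v) (Q := P.bar) (g₁ := invList g₂)
      (g₂ := invList g₁) (p := q.bar) (u := u) (q := p.bar) (m := n.bar)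
      (by simpa only [bar_mul] using hN.bar) hv
      (by
        rw [eval_append] at hg ⊢
        rw [eval_invList, eval_invList, ← mul_inv_rev, hg, inv_one])
      (by rw [ofList_invList, h5, bar_mul, bar_bar])
      (by rw [h6, bar_mul, bar_mul, bar_bar])
      (by rw [← bar_mul, h₁, ofList_invList, bar_mul, bar_mul])
    simpa only [bar_mul, bar_bar] using this.bar
  have h7 : u = n.bar * ofList (invList g₂) := by
    rw [← bar_bar u, h5, bar_mul, ofList_invList]
  rw [eval_append] at hg
  -- The word u ends in g₁ and also in the inverse of g₂, which have the same value. If one were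
  -- longer, its surplus would be a nonempty finite factor of u of value 1.
  have hmn : n.bar = m := by
    rcases levi (h4.symm.trans h7) with ⟨k, h8, h9⟩ | ⟨k, h8, h9⟩
    · obtain ⟨k, g₃, rfl, rfl, h10⟩ := ofList_eq_mul h9
      have h11 := hu
      rw [h4] at h11
      rw [ofList_append, ← mul_assoc] at h11
      obtain rfl := h11.list_eq_nil (by
        obtain rfl := ofList_inj h10
        simpa [eval_append, eval_invList] using hg)
      simpa using h8
    · obtain ⟨k, g₃, h12, rfl, h10⟩ := ofList_eq_mul h9
      have h11 := hu
      rw [h7, h12] at h11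
      rw [ofList_append, ← mul_assoc] at h11
      obtain rfl := h11.list_eq_nil (by
        obtain rfl := ofList_inj h10
        have := congrArg (eval S) h12
        rw [eval_invList, eval_append] at this
        rw [← inv_inj, inv_one, mul_inv_rev, this, mul_assoc, mul_inv_cancel, mul_one] at hg
        exact hg)
      simpa using h8.symm
  have hmr : GReduced m := by rw [h4] at hu; exact hu.left
  have hnm : n = m.bar := by rw [← hmn, bar_bar]
  subst hnm
  rcases levi h3 with ⟨k, rfl, rfl⟩ | ⟨k, rfl, rfl⟩
  · rw [bar_mul, mul_assoc] at h6
    obtain rfl := mul_left_inj' h6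
    refine hN.insert P Q k [] rfl hv.left rfl (by simp only [ofList_nil, mul_one, mul_assoc])
  · rw [bar_mul, mul_assoc] at h6
    have := mul_left_inj' h6
    subst this
    exact ih p k q (by simp only [mul_assoc]) hmr.left

/-- The cut lies inside v = e₁ k. Since v is reduced, it cannot contain y ȳ with y nonempty around
the cut, so either k, or e₁, or u is empty, and each of these reduces to an easier situation. -/
theorem Null.cancel_mid_left {P v Q p u q e₁ e₂ : Word (Letters S)} {g : List (Letters S)} {k}
    (hN : Null (P * Q))
    (ih : ∀ p' u' q' : Word (Letters S), P * Q = p' * u' * u'.bar * q' → GReduced u' →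
      Null (p' * q'))
    (hu : GReduced u) (hv : GReduced v) (hg : eval S g = 1)
    (h₁ : p * u = P * e₁) (h₂ : u.bar * q = e₂ * Q) (hv' : v = e₁ * k)
    (he : e₂ = k * (ofList g * v.bar)) : Null (p * q) := by
  by_cases hk : k = 1
  · subst hk
    rw [mul_one] at hv'
    subst hv'
    refine hN.cancel_center (g₁ := []) (g₂ := g) ih hu hv hg (by simpa using h₁) ?_
    rw [h₂, he]
    simp only [one_mul, mul_assoc]
  have hk' : ∀ x y : Word (Letters S), v = x * (y.bar * k.bar) * k → False := by
    intro x y h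
    rw [h, mul_assoc, mul_assoc] at hv
    have := GReduced.mul_bar (x := k.bar) (by rw [bar_bar]; exact hv.right.right)
    exact hk (bar_eq_one.1 this)
  have hbb : ∀ x y z : Word (Letters S), v = x * y * y.bar * z → y = 1 := by
    intro x y z h
    rw [h, mul_assoc, mul_assoc, ← mul_assoc y] at hv
    exact hv.right.left.mul_bar
  rcases levi h₁ with ⟨m, rfl, h3⟩ | ⟨m, rfl, rfl⟩
  · rw [he, h3, mul_assoc, bar_mul, mul_assoc] at h₂
    rcases levi h₂ with ⟨n, hn, h4⟩ | ⟨n, h4, h5⟩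
    · obtain rfl := hbb 1 e₁ n (by rw [hv', hn]; simp only [one_mul, mul_assoc])
      rw [mul_one] at h3
      rw [one_mul] at hv'
      subst h3 hv'
      refine Null.cancel_left (y := 1) (by simpa only [mul_one] using hN)
        (by simpa only [mul_one] using ih) hu hv hg ?_
      rw [bar_one, one_mul] at h₂
      simpa only [one_mul, mul_assoc] using h₂
    · refine (hk' n.bar 1 ?_).elim
      rw [hv', ← bar_bar e₁, h4, bar_mul, bar_one, one_mul]
  · rw [he, mul_assoc] at h₂
    rcases levi h₂ with ⟨n, hn, h4⟩ | ⟨n, h4, h5⟩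
    · obtain rfl := hbb m u n (by rw [hv', hn]; simp only [mul_assoc])
      rw [bar_one, one_mul] at h₂
      rw [mul_one] at hv'
      refine hN.insert P Q v g rfl hv hg ?_
      rw [h₂]
      nth_rw 2 [hv']
      simp only [mul_assoc]
    · refine (hk' m n ?_).elim
      rw [hv', ← bar_bar u, h4, bar_mul]

theorem Null.cancel {x : Word (Letters S)} (h : Null x) : ∀ p u q : Word (Letters S),
    x = p * u * u.bar * q → GReduced u → Null (p * q) := by
  induction h with
  | one =>
    intro p u q h _
    obtain rfl := mul_eq_one_right h.symm
    have h1 := mul_eq_one_left (mul_eq_one_left (mul_eq_one_left h.symm))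
    rw [h1, one_mul]
    exact Null.one
  | ins P Q v g hN hv hg ih =>
    intro p u q h hu
    have ih' : ∀ p' u' q' : Word (Letters S), Q.bar * P.bar = p' * u' * u'.bar * q' →
        GReduced u' → Null (p' * q') := by
      intro p' u' q' h1 h2
      have := (ih q'.bar u' p'.bar ?_ h2).bar
      · simpa only [bar_mul, bar_bar] using this
      · apply bar_inj
        rw [bar_mul, h1]
        simp only [bar_mul, bar_bar, mul_assoc]
    have hN' : Null (Q.bar * P.bar) := by simpa only [bar_mul] using hN.bar
    have hg' : eval S (invList g) = 1 := by rw [eval_invList, hg, inv_one]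
    have h1 : p * u * (u.bar * q) = P * ((v * ofList g * v.bar) * Q) := by
      simpa only [mul_assoc] using h.symm
    rcases levi h1 with ⟨y, rfl, h2⟩ | ⟨y, h2, h3⟩
    · exact Null.cancel_left hN ih hu hv hg h2
    rcases levi h3 with ⟨z, rfl, rfl⟩ | ⟨z, h4, h5⟩
    · have := Null.cancel_left (p := q.bar) (u := u) (y := z.bar) (q := p.bar) (v := v)
        (g := invList g) (Q := P.bar) ?_ ?_ hu hv hg' ?_
      · simpa only [bar_mul, bar_bar] using this.bar
      · simpa only [bar_mul, bar_bar, mul_assoc] using hN'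
      · simpa only [bar_mul, bar_bar, mul_assoc] using ih'
      · apply bar_inj
        simpa only [bar_mul, bar_bar, ofList_invList, mul_assoc] using h2
    · rw [mul_assoc] at h4
      rcases levi h4 with ⟨k, h6, h7⟩ | ⟨k, h6, h7⟩
      swap
      · exact hN.cancel_mid_left ih hu hv hg h2 h5 h6 h7
      rcases levi h7 with ⟨n, h8, h9⟩ | ⟨n, h8, h9⟩
      · have := hN'.cancel_mid_left (v := v) (p := q.bar) (u := u) (q := p.bar) (e₁ := z.bar)
          (e₂ := y.bar) (g := invList g) (k := n.bar) ih' hu hv hg' ?_ ?_ ?_ ?_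
        · simpa only [bar_mul, bar_bar] using this.bar
        · apply bar_inj
          simpa only [bar_mul, bar_bar] using h5
        · apply bar_inj
          simpa only [bar_mul, bar_bar] using h2
        · apply bar_inj
          simpa only [bar_mul, bar_bar] using h9
        · apply bar_inj
          rw [h6, h8]
          simp only [bar_mul, bar_bar, ofList_invList, mul_assoc]
      · obtain ⟨g₁, g₂, rfl, rfl, rfl⟩ := ofList_eq_mul h8
        refine hN.cancel_center ih hu hv hg (by rw [h2, h6, mul_assoc]) (by rw [h5, h9, mul_assoc])

/-- Being interchangeable inside null words, in every context, is a congruence. It contains the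
defining relations: one direction is an insertion, the other empties the finite centre by
`Null.change` and then removes u ū by `Null.cancel`. -/
theorem null_of_toM {x : Word (Letters S)} (h : toM S x = 1) : Null x := by
  let c : Con (Word (Letters S)) :=
    { r := fun x y => ∀ p q : Word (Letters S), Null (p * x * q) ↔ Null (p * y * q)
      iseqv := ⟨fun _ _ _ => Iff.rfl, fun h p q => (h p q).symm,
        fun h h' p q => (h p q).trans (h' p q)⟩
      mul' := fun {a b a' b'} h h' p q => by
        have h1 := h p (a' * q)
        have h2 := h' (p * b) q
        simp only [mul_assoc] at h1 h2 ⊢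
        exact h1.trans h2 }
  have hc : relCon S ≤ c := by
    refine Con.conGen_le.2 ?_
    rintro x y ⟨u, l, r, hu, hlr, rfl, rfl⟩
    have hf : eval S (l ++ invList r) = 1 := by
      rw [eval_append, eval_invList, hlr, mul_inv_cancel]
    intro p q
    rw [mul_one]
    constructor
    · intro h
      have h1 := h.change (p * u) (l ++ invList r) (u.bar * q) []
        (by simp only [ofList_append, ofList_invList, mul_assoc]) hf
      rw [ofList_nil, mul_one] at h1
      exact h1.cancel p u q (by simp only [mul_assoc]) hu
    · intro h
      refine h.insert p q u (l ++ invList r) rfl hu hf ?_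
      simp only [ofList_append, ofList_invList, mul_assoc]
  have h1 : relCon S x 1 := (Con.eq _).1 h
  have h2 := hc h1 1 1
  simp only [mul_one, one_mul] at h2
  exact h2.2 Null.one

theorem IsRelator.toM_eq_one {x : Word (Letters S)} (h : IsRelator x) : toM S x = 1 := by
  obtain ⟨u, f, hu, hf, rfl⟩ := h
  rw [← map_one (toM S)]
  refine (Con.eq _).2 (ConGen.Rel.of _ _ ⟨u, f, [], hu, hf, ?_, rfl⟩)
  rw [ofList_nil, bar_one, mul_one]

/-- The relator inserted last is a factor of a reduced word, hence empty. In particular a nonempty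
reduced word is nontrivial in M(A,G). -/
theorem Null.eq_one {x : Word (Letters S)} (h : Null x) (hx : GReduced x) : x = 1 := by
  induction h with
  | one => rfl
  | ins p q u f hN hu hf ih =>
    have h1 : u * ofList f * u.bar = 1 := IsRelator.eq_one ⟨u, f, hu, hf, rfl⟩ hx.left.right
    rw [h1, mul_one] at hx ⊢
    exact ih hx

end null

/-! ### Britton's argument for a rigid stable letter -/

section forms

variable {G : Type*} [Group G] {S : Set G}

open Word

/-- A convex subgroup of `ℤ[t]` which contains `1`. -/
structure IsConvex (C : AddSubgroup ZT) : Prop where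
  one_mem : 1 ∈ C
  mem_of_le : ∀ {a b : ZT}, 0 ≤ a → a ≤ b → b ∈ C → a ∈ C

theorem IsConvex.lt {C : AddSubgroup ZT} (hC : IsConvex C) {a b : ZT} (ha : a ∈ C) (hb : b ∉ C)
    (h0 : 0 ≤ b) : a < b := by
  by_contra h
  exact hb (hC.mem_of_le h0 (not_lt.1 h) ha)

theorem IsConvex.left {C : AddSubgroup ZT} (hC : IsConvex C) {Γ : Type*} {x y : Word Γ}
    (h : (x * y).len ∈ C) : x.len ∈ C :=
  hC.mem_of_le x.len_nonneg (by rw [len_mul]; linarith [y.len_nonneg]) h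

theorem IsConvex.right {C : AddSubgroup ZT} (hC : IsConvex C) {Γ : Type*} {x y : Word Γ}
    (h : (x * y).len ∈ C) : y.len ∈ C :=
  hC.mem_of_le y.len_nonneg (by rw [len_mul]; linarith [x.len_nonneg]) h

theorem IsConvex.ofList {C : AddSubgroup ZT} (hC : IsConvex C) {Γ : Type*} (l : List Γ) :
    (Word.ofList l).len ∈ C := by
  rw [len_ofList, ← nsmul_one]
  exact C.nsmul_mem hC.one_mem _

theorem mul_len_mem {C : AddSubgroup ZT} {Γ : Type*} {x y : Word Γ}
    (hx : x.len ∈ C) (hy : y.len ∈ C) : (x * y).len ∈ C := C.add_mem hx hy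

theorem one_len_mem {C : AddSubgroup ZT} {Γ : Type*} : (1 : Word Γ).len ∈ C := C.zero_mem

/-- If a long word and a short one start at the same place, the short one is a prefix. -/
theorem IsConvex.prefix {C : AddSubgroup ZT} (hC : IsConvex C) {Γ : Type*} {p q p' q' : Word Γ}
    (h : p * q = p' * q') (hp : p.len ∈ C) (hp' : p'.len ∉ C) :
    ∃ m, p' = p * m ∧ q = m * q' ∧ m.len ∉ C := by
  obtain ⟨m, rfl, rfl⟩ := levi_of_le h (hC.lt hp hp' p'.len_nonneg).le
  exact ⟨m, rfl, rfl, fun hm => hp' (mul_len_mem hp hm)⟩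

/-- `s` or `s̄`, according to the sign. -/
noncomputable def signed (s : Word (Letters S)) (e : ℤˣ) : Word (Letters S) :=
  if e = 1 then s else s.bar

theorem signed_one (s : Word (Letters S)) : signed s 1 = s := if_pos rfl

theorem signed_neg_one (s : Word (Letters S)) : signed s (-1) = s.bar := if_neg (by decide)

theorem signed_neg (s : Word (Letters S)) (e : ℤˣ) : signed s (-e) = (signed s e).bar := by
  rcases Int.units_eq_one_or e with rfl | rfl
  · rw [signed_one, signed_neg_one]
  · rw [neg_neg, signed_one, signed_neg_one, bar_bar]

theorem len_signed (s : Word (Letters S)) (e : ℤˣ) : (signed s e).len = s.len := by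
  rcases Int.units_eq_one_or e with rfl | rfl
  · rw [signed_one]
  · rw [signed_neg_one, len_bar]

theorem GReduced.signed {s : Word (Letters S)} (hs : GReduced s) (e : ℤˣ) :
    GReduced (signed s e) := by
  rcases Int.units_eq_one_or e with rfl | rfl
  · rwa [signed_one]
  · rw [signed_neg_one]
    exact hs.bar

/-- `Y` is a product `g₀ σ₁ g₁ ⋯ σₙ gₙ`, where the `σᵢ` arise from `s` or `s̄` by cutting off short
pieces at both ends, and where the `gᵢ` are short and represent the given elements of `M(A,G)`
(the first one being `m`) up to these pieces. -/
def Form (C : AddSubgroup ZT) (s : Word (Letters S)) :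
    MonM S → List (ℤˣ × MonM S) → Word (Letters S) → Prop
  | m, [], Y => Y.len ∈ C ∧ toM S Y = m
  | m, (e, h) :: L, Y => ∃ g σ Y' x z : Word (Letters S), Y = g * (σ * Y') ∧
      signed s e = x * (σ * z) ∧ g.len ∈ C ∧ x.len ∈ C ∧ z.len ∈ C ∧ toM S g = m * toM S x ∧
      Form C s (toM S z * h) L Y'

variable {C : AddSubgroup ZT} {s : Word (Letters S)}

theorem core_not_mem (hs : s.len ∉ C) {e : ℤˣ} {x σ z : Word (Letters S)}
    (h : signed s e = x * (σ * z)) (hx : x.len ∈ C) (hz : z.len ∈ C) : σ.len ∉ C := by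
  intro hσ
  apply hs
  rw [← len_signed s e, h]
  exact mul_len_mem hx (mul_len_mem hσ hz)

theorem Form.drop_prefix (hC : IsConvex C) (hs : s.len ∉ C) {m : MonM S}
    {L : List (ℤˣ × MonM S)} {k : MonM S} {E q : Word (Letters S)} (h : Form C s m L (E * q))
    (hE : E.len ∈ C) (hk : k * toM S E = 1) : Form C s (k * m) L q := by
  cases L with
  | nil =>
    obtain ⟨h1, rfl⟩ := h
    refine ⟨hC.right h1, ?_⟩
    rw [map_mul, ← mul_assoc, hk, one_mul]
  | cons eh L =>
    obtain ⟨e, h'⟩ := eh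
    obtain ⟨g, σ, Y', x, z, h1, h2, hg, hx, hz, h3, h4⟩ := h
    have hσ := core_not_mem hs h2 hx hz
    rcases levi h1 with ⟨n, rfl, rfl⟩ | ⟨n, rfl, h5⟩
    · refine ⟨n, σ, Y', x, z, rfl, h2, hC.right hg, hx, hz, ?_, h4⟩
      rw [mul_assoc, ← h3, map_mul, ← mul_assoc, hk, one_mul]
    · obtain ⟨σ', rfl, rfl, -⟩ := hC.prefix h5.symm (hC.right hE) hσ
      refine ⟨1, σ', Y', x * n, z, (one_mul _).symm, ?_, one_len_mem,
        mul_len_mem hx (hC.right hE), hz, ?_, h4⟩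
      · rw [h2]; simp only [mul_assoc]
      · rw [map_mul, mul_assoc, ← mul_assoc m, ← h3, map_one, ← map_mul, hk]

/-- A short relator meets a long core σ in one of two ways. Inside σ it is empty, because σ is
reduced. Across an end of σ, the part lying in σ is cut off and transferred to x or z, which keeps
the represented elements unchanged. -/
theorem Form.delete (hC : IsConvex C) (hs : s.len ∉ C) (hsr : GReduced s) {m : MonM S}
    {L : List (ℤˣ × MonM S)} {p E q : Word (Letters S)} (h : Form C s m L (p * (E * q)))
    (hE : E.len ∈ C) (hR : IsRelator E) : Form C s m L (p * q) := by
  induction L generalizing m p with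
  | nil =>
    obtain ⟨h1, rfl⟩ := h
    refine ⟨mul_len_mem (hC.left h1) (hC.right (hC.right h1)), ?_⟩
    rw [map_mul, map_mul, map_mul, hR.toM_eq_one, one_mul]
  | cons eh L ih =>
    obtain ⟨e, h'⟩ := eh
    obtain ⟨g, σ, Y', x, z, h1, h2, hg, hx, hz, h3, h4⟩ := h
    have hσ := core_not_mem hs h2 hx hz
    rcases levi h1 with ⟨n, rfl, h5⟩ | ⟨n, rfl, h5⟩
    · rcases levi h5 with ⟨k, rfl, rfl⟩ | ⟨k, rfl, h6⟩
      · refine ⟨p * k, σ, Y', x, z, by simp only [mul_assoc], h2,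
          mul_len_mem (hC.left hg) (hC.right (hC.right hg)), hx, hz, ?_, h4⟩
        rw [← h3, map_mul, map_mul, map_mul, hR.toM_eq_one, one_mul]
      · obtain ⟨σ', rfl, rfl, -⟩ := hC.prefix h6.symm (hC.right hE) hσ
        refine ⟨p, σ', Y', x * k, z, rfl, by rw [h2]; simp only [mul_assoc], hC.left hg,
          mul_len_mem hx (hC.right hE), hz, ?_, h4⟩
        rw [map_mul, ← mul_assoc, ← h3, ← map_mul, mul_assoc, map_mul, hR.toM_eq_one, mul_one]
    · rcases levi h5 with ⟨k, rfl, rfl⟩ | ⟨k, rfl, h6⟩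
      · refine ⟨g, σ, k * q, x, z, by simp only [mul_assoc], h2, hg, hx, hz, h3, ih h4⟩
      · rcases levi h6 with ⟨j, rfl, rfl⟩ | ⟨j, rfl, rfl⟩
        · have hE1 : E = 1 := by
            refine hR.eq_one ?_
            have := hsr.signed e
            rw [h2] at this
            exact this.right.left.right.left
          subst hE1
          exact ⟨g, n * j, Y', x, z, by simp only [mul_assoc],
            by rw [h2, one_mul], hg, hx, hz, h3, h4⟩
        · have hk := hR.toM_eq_one
          rw [map_mul] at hk
          have := h4.drop_prefix hC hs (hC.right hE) hk
          refine ⟨g, n, q, x, k * z, by simp only [mul_assoc], by rw [h2]; simp only [mul_assoc],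
            hg, hx, mul_len_mem (hC.left hE) hz, h3, ?_⟩
          rwa [map_mul, mul_assoc]

/-- The cut between `P` and `Q` is close to the piece between two successive occurrences of `s`
or `s̄`. -/
def Junction (C : AddSubgroup ZT) (s : Word (Letters S)) (L : List (ℤˣ × MonM S))
    (P Q : Word (Letters S)) : Prop :=
  ∃ (L₁ L₂ : List (ℤˣ × MonM S)) (e e' : ℤˣ) (h h' : MonM S)
    (A B σ σ' a b x z x' z' : Word (Letters S)), L = L₁ ++ (e, h) :: (e', h') :: L₂ ∧
    P = A * (σ * a) ∧ Q = b * (σ' * B) ∧ signed s e = x * (σ * z) ∧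
    signed s e' = x' * (σ' * z') ∧ a.len ∈ C ∧ b.len ∈ C ∧ x.len ∈ C ∧ z.len ∈ C ∧ x'.len ∈ C ∧
    z'.len ∈ C ∧ toM S (a * b) = toM S z * h * toM S x'

theorem Form.locate (hC : IsConvex C) (hs : s.len ∉ C) (hsr : GReduced s) {m : MonM S}
    {L : List (ℤˣ × MonM S)} {P Q : Word (Letters S)} (h : Form C s m L (P * Q)) :
    P.len ∈ C ∨ Q.len ∈ C ∨ (∃ A σ₁ σ₂ B : Word (Letters S), P = A * σ₁ ∧ Q = σ₂ * B ∧
      σ₁.len ∉ C ∧ σ₂.len ∉ C ∧ GReduced (σ₁ * σ₂)) ∨ Junction C s L P Q := by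
  induction L generalizing m P with
  | nil => exact Or.inl (hC.left h.1)
  | cons eh L ih =>
    obtain ⟨e, h'⟩ := eh
    obtain ⟨g, σ, Y', x, z, h1, h2, hg, hx, hz, h3, h4⟩ := h
    have hσ := core_not_mem hs h2 hx hz
    rcases levi h1 with ⟨n, rfl, -⟩ | ⟨n, rfl, h5⟩
    · exact Or.inl (hC.left hg)
    rcases levi h5 with ⟨y, rfl, rfl⟩ | ⟨σ₂, rfl, rfl⟩
    · rcases ih h4 with hy | hQ | ⟨A, σ₁, σ₂, B, rfl, rfl, h6, h7, h8⟩ | h6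
      · cases L with
        | nil => exact Or.inr (Or.inl (hC.right h4.1))
        | cons eh L =>
          obtain ⟨e₂, h₂⟩ := eh
          obtain ⟨g', σ', Y'', x', z', k1, k2, hg', hx', hz', k3, k4⟩ := h4
          refine Or.inr (Or.inr (Or.inr ?_))
          rcases levi k1 with ⟨b, rfl, rfl⟩ | ⟨c, rfl, k5⟩
          · exact ⟨[], L, e, e₂, h', h₂, g, Y'', σ, σ', y, b, x, z, x', z', rfl, rfl, rfl, h2, k2, hy,
              hC.right hg', hx, hz, hx', hz', k3⟩
          · have hσ' := core_not_mem hs k2 hx' hz'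
            obtain ⟨σ'', rfl, rfl, -⟩ := hC.prefix k5.symm (hC.right hy) hσ'
            refine ⟨[], L, e, e₂, h', h₂, g, Y'', σ, σ'', g' * c, 1, x, z, x' * c, z', rfl, rfl,
              (one_mul _).symm, h2, by rw [k2]; simp only [mul_assoc], hy, one_len_mem, hx, hz,
              mul_len_mem hx' (hC.right hy), hz', ?_⟩
            rw [mul_one, map_mul, k3, map_mul, mul_assoc]
      · exact Or.inr (Or.inl hQ)
      · exact Or.inr (Or.inr (Or.inl ⟨g * (σ * A), σ₁, σ₂, B, by simp only [mul_assoc], rfl, h6, h7, h8⟩))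
      · obtain ⟨L₁, L₂, e₁, e₂, h₁, h₂, A, B, σ₁, σ₂, a, b, x, z, x', z', rfl, rfl, rfl, rest⟩ := h6
        refine Or.inr (Or.inr (Or.inr ⟨(e, h') :: L₁, L₂, e₁, e₂, h₁, h₂, g * (σ * A), B, σ₁, σ₂, a, b,
          x, z, x', z', rfl, by simp only [mul_assoc], rfl, rest⟩))
    · by_cases hn : n.len ∈ C
      · exact Or.inl (mul_len_mem hg hn)
      by_cases hσ₂ : σ₂.len ∈ C
      swap
      · refine Or.inr (Or.inr (Or.inl ⟨g, n, σ₂, Y', rfl, rfl, hn, hσ₂, ?_⟩))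
        have := hsr.signed e
        rw [h2] at this
        exact this.right.left
      cases L with
      | nil => exact Or.inr (Or.inl (mul_len_mem hσ₂ h4.1))
      | cons eh L =>
        obtain ⟨e₂, h₂⟩ := eh
        obtain ⟨g', σ', Y'', x', z', rfl, k2, hg', hx', hz', k3, k4⟩ := h4
        refine Or.inr (Or.inr (Or.inr ⟨[], L, e, e₂, h', h₂, g, Y'', n, σ', 1, σ₂ * g', x, σ₂ * z, x', z',
          rfl, by rw [mul_one], by simp only [mul_assoc], by rw [h2]; simp only [mul_assoc], k2,
          one_len_mem, mul_len_mem hσ₂ hg', hx, mul_len_mem hσ₂ hz, hx', hz', ?_⟩))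
        rw [one_mul, map_mul, k3, map_mul]
        simp only [mul_assoc]

/-- The words `x` and `y` agree, up to the shift `γ`, at all sufficiently large positions
in `C`. -/
def ShiftEq (C : AddSubgroup ZT) {Γ : Type*} (x y : Word Γ) (γ : ZT) : Prop :=
  ∃ β₀ ∈ C, ∀ β ∈ C, β₀ ≤ β → x.letter β = y.letter (β + γ)

theorem letter_mid {Γ : Type*} (x σ z : Word Γ) {β : ZT} (h0 : x.len < β)
    (h1 : β ≤ x.len + σ.len) : (x * (σ * z)).letter β = σ.letter (β - x.len) := by
  rw [letter_mul_of_lt _ _ h0, letter_mul_of_le _ _ (by linarith)]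

theorem shiftEq_of_common_prefix (hC : IsConvex C) {Γ : Type*}
    {U p q a σ A b σ' B x z x' z' : Word Γ} (hU : U.len ∉ C) (h₁ : U * p = a * (σ * A))
    (h₂ : U * q = b * (σ' * B)) (hσ : σ.len ∉ C) (hσ' : σ'.len ∉ C) (ha : a.len ∈ C)
    (hb : b.len ∈ C) (hz : z.len ∈ C) (hx : x.len ∈ C) :
    ShiftEq C (z * (σ * z')) (x * (σ' * x')) (a.len - z.len - b.len + x.len) := by
  -- Beyond this bound all shifted positions are past the short pieces. Being in C, they have not
  -- yet reached the ends of the long words U, σ and σ'.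
  refine ⟨a.len + z.len + b.len + x.len + 1, C.add_mem (C.add_mem (C.add_mem
    (C.add_mem ha hz) hb) hx) hC.one_mem, fun β hβ h0 => ?_⟩
  have := a.len_nonneg
  have := b.len_nonneg
  have := x.len_nonneg
  have := z.len_nonneg
  have := ZT.zero_lt_one
  have l1 := hC.lt (C.sub_mem hβ hz) hσ σ.len_nonneg
  have l2 := hC.lt (C.add_mem (C.sub_mem hβ hz) ha) hU U.len_nonneg
  have l3 := hC.lt (C.sub_mem (C.add_mem (C.sub_mem hβ hz) ha) hb) hσ' σ'.len_nonneg
  rw [letter_mid z σ z' (by linarith) (by linarith), letter_mid x σ' x' (by linarith) (by linarith)]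
  have e1 := letter_mul_of_le U p (β := β - z.len + a.len) l2.le
  have e2 := letter_mul_of_le U q (β := β - z.len + a.len) l2.le
  rw [h₁, letter_mid _ _ _ (by linarith) (by linarith)] at e1
  rw [h₂, letter_mid _ _ _ (by linarith) (by linarith), ← e1] at e2
  rw [add_sub_cancel_right] at e2
  rw [← e2]
  congr 1
  ring

/-- The properties of the word `s` which represents the stable letter. Here `W 1 = u` and
`W (-1) = v̄`. -/
structure IsStable (C : AddSubgroup ZT) (s : Word (Letters S)) (W : ℤˣ → Word (Letters S))
    (α : ZT) : Prop where
  len_not_mem : s.len ∉ C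
  reduced : GReduced s
  len_W : ∀ e, (W e).len = α
  -- For e = 1 this is u s = s v, for e = -1 it is v̄ s̄ = s̄ ū.
  comm : ∀ e, W e * signed s e = signed s e * (W (-e)).bar
  -- The rigidity of s, which turns a long overlap of two occurrences into a pinch.
  shift : ∀ e e' γ, γ ∈ C → ShiftEq C (signed s e) (signed s e') γ →
    e = e' ∧ ∃ k : ℤ, γ = k * α

theorem Word.len_pow {Γ : Type*} (x : Word Γ) (k : ℕ) : (x ^ k).len = k * x.len := by
  induction k with
  | zero => simp
  | succ k ih => rw [pow_succ, len_mul, ih]; push_cast; ring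

theorem IsStable.pow_comm {W : ℤˣ → Word (Letters S)} {α : ZT} (hst : IsStable C s W α) (e : ℤˣ)
    (k : ℕ) : W e ^ k * signed s e = signed s e * (W (-e)).bar ^ k := by
  induction k with
  | zero => simp
  | succ k ih => rw [pow_succ, mul_assoc, hst.comm, ← mul_assoc, ih, mul_assoc, ← pow_succ]

theorem IsStable.prefix_eq {W : ℤˣ → Word (Letters S)} {α : ZT} (hst : IsStable C s W α) {e : ℤˣ}
    {k : ℕ} {y₁ r₁ y₂ r₂ : Word (Letters S)} (h₁ : signed s e = y₁ * r₁)
    (h₂ : signed s e = y₂ * r₂) (hl : y₂.len = y₁.len + k * α) : y₂ = W e ^ k * y₁ := by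
  have h := hst.pow_comm e k
  nth_rw 1 [h₁] at h
  rw [h₂, ← mul_assoc, mul_assoc y₂] at h
  refine (mul_inj_of_len h ?_).1.symm
  rw [len_mul, len_pow, hst.len_W, hl]
  ring

/-- The list of signs and elements contains no pinch. -/
def NoPinch (W : ℤˣ → Word (Letters S)) (L : List (ℤˣ × MonM S)) : Prop :=
  ∀ L₁ L₂ e h h', L = L₁ ++ (e, h) :: (-e, h') :: L₂ → ∀ k : ℕ,
    h ≠ toM S (W (-e) ^ k) ∧ h ≠ toM S ((W (-e) ^ k).bar)

/-- If u were long, then ū would be a common prefix of the inverse of the left side and, after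
removing f, of the right side. So s^(-e) and s^e' agree far out up to a shift in C. Rigidity gives
e' = -e and a shift kα, and the element h between the occurrences becomes a quotient of two prefixes
of s^(-e) whose lengths differ by kα, that is, a power of `W (-e)` or its inverse. -/
theorem Junction.relator_mem (hC : IsConvex C) {W : ℤˣ → Word (Letters S)} {α : ZT}
    (hst : IsStable C s W α) {L : List (ℤˣ × MonM S)} (hL : NoPinch W L)
    {p u q : Word (Letters S)} {f : List (Letters S)} (hu : GReduced u) (hf : eval S f = 1)
    (h : Junction C s L (p * u) (ofList f * (u.bar * q))) : u.len ∈ C := by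
  obtain ⟨L₁, L₂, e, e', h, h', A, B, σ, σ₀, a, b₀, x, z, x₀, z', hLe, hP, hQ, hx, hx₀, ma, mb₀, mx, mz,
    mx₀, mz', hab₀⟩ := h
  by_contra hnu
  have hs := hst.len_not_mem
  have hff : toM S (ofList f) = 1 := IsRelator.toM_eq_one ⟨1, f, gReduced_one, hf, by
    rw [bar_one, one_mul, mul_one]⟩
  -- The finite word f has value 1. It is removed from b₀ if it lies there; otherwise it reaches
  -- into σ₀, and the overlap is transferred to x₀.
  obtain ⟨b, σ', x', hQ', hx', mb, mx', hab⟩ : ∃ b σ' x' : Word (Letters S),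
      u.bar * q = b * (σ' * B) ∧ signed s e' = x' * (σ' * z') ∧ b.len ∈ C ∧ x'.len ∈ C ∧
      toM S (a * b) = toM S z * h * toM S x' := by
    rcases levi hQ with ⟨b, rfl, hb⟩ | ⟨c, hc, h5⟩
    · refine ⟨b, σ₀, x₀, hb, hx₀, hC.right mb₀, mx₀, ?_⟩
      rw [← hab₀, map_mul, map_mul, map_mul, hff, one_mul]
    · have mc : c.len ∈ C := hC.right (hc ▸ hC.ofList f)
      obtain ⟨σ', rfl, h6, -⟩ := hC.prefix h5.symm mc (core_not_mem hs hx₀ mx₀ mz')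
      refine ⟨1, σ', x₀ * c, by rw [h6, one_mul], by rw [hx₀]; simp only [mul_assoc], one_len_mem,
        mul_len_mem mx₀ mc, ?_⟩
      rw [mul_one, map_mul _ x₀, ← mul_assoc, ← hab₀, ← map_mul, mul_assoc, ← hc, map_mul, hff,
        mul_one]
  have hσ := core_not_mem hs hx mx mz
  have hσ' := core_not_mem hs hx' mx' mz'
  have hP' : u.bar * p.bar = a.bar * (σ.bar * A.bar) := by
    rw [← bar_mul, hP]
    simp only [bar_mul, mul_assoc]
  have hxb : signed s (-e) = z.bar * (σ.bar * x.bar) := by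
    rw [signed_neg, hx]
    simp only [bar_mul, mul_assoc]
  have hsh := shiftEq_of_common_prefix hC (U := u.bar) (z := z.bar) (z' := x.bar) (x := x') (x' := z') hnu hP'
    hQ' hσ hσ' ma mb mz mx'
  rw [← hxb, ← hx'] at hsh
  obtain ⟨rfl, k, hk⟩ := hst.shift _ _ _ (C.add_mem (C.sub_mem (C.sub_mem ma mz) mb) mx') hsh
  -- Both ā and b are prefixes of ū, hence comparable. The shorter one is completed to the longer
  -- one along its own occurrence of s^(-e), and the other completion is empty.
  obtain ⟨y, y', hyy, ⟨r₁, hr₁⟩, ⟨r₂, hr₂⟩⟩ : ∃ y y' : Word (Letters S), a.bar * y = b * y' ∧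
      (∃ r, signed s (-e) = (z.bar * y) * r) ∧ ∃ r, signed s (-e) = (x' * y') * r := by
    obtain ⟨ua, hua, h5, -⟩ := hC.prefix hP'.symm ma hnu
    obtain ⟨ub, hub, h6, -⟩ := hC.prefix hQ'.symm mb hnu
    rcases levi (hua.symm.trans hub) with ⟨c, rfl, rfl⟩ | ⟨c, hc, rfl⟩
    · rw [mul_assoc] at h5
      obtain ⟨σ₂, h7, -⟩ := hC.prefix h5.symm (hC.right mb) hσ
      exact ⟨c, 1, (mul_one _).symm, ⟨σ₂ * x.bar, by rw [hxb, h7]; simp only [mul_assoc]⟩,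
        ⟨σ' * z', by rw [hx', mul_one]⟩⟩
    · rw [mul_assoc] at h6
      have mc : c.len ∈ C := hC.right (y := c) (x := b) (hc ▸ ma)
      obtain ⟨σ₂, h7, -⟩ := hC.prefix h6.symm mc hσ'
      exact ⟨1, c, by rw [hc, mul_one], ⟨σ.bar * x.bar, by rw [hxb, mul_one]⟩,
        ⟨σ₂ * z', by rw [hx', h7]; simp only [mul_assoc]⟩⟩
  have hred := hst.reduced.signed (-e)
  have hy₁ : GReduced (z.bar * y) := by rw [hr₁] at hred; exact hred.left
  have hy₂ : GReduced (x' * y') := by rw [hr₂] at hred; exact hred.left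
  have har : GReduced a := by
    obtain ⟨ua, hua, -⟩ := hC.prefix hP'.symm ma hnu
    have := hu.bar
    rw [hua] at this
    simpa only [bar_bar] using this.left.bar
  have hh : h = toM S (z.bar * y) * toM S (x' * y').bar := by
    have h1 : h = toM S z.bar * (toM S z * h * toM S x') * toM S x'.bar := by
      have hzr : GReduced z := by simpa only [bar_bar] using hy₁.left.bar
      rw [mul_assoc, mul_assoc, mul_assoc, toM_mul_bar hy₂.left, mul_one, ← mul_assoc,
        toM_bar_mul hzr, one_mul]
    have h2 : toM S b = toM S a.bar * toM S y * toM S y'.bar := by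
      rw [← map_mul, hyy, map_mul, mul_assoc, toM_mul_bar hy₂.right, mul_one]
    rw [h1, ← hab, map_mul, h2, bar_mul, map_mul, map_mul, ← mul_assoc (toM S a),
      ← mul_assoc (toM S a), toM_mul_bar har, one_mul]
    simp only [mul_assoc]
  have hlen : (x' * y').len = (z.bar * y).len + k * α := by
    have := congrArg len hyy
    simp only [len_mul, len_bar] at this hk ⊢
    linarith
  rcases Int.eq_nat_or_neg k with ⟨n, rfl | rfl⟩
  · have h1 := hst.prefix_eq hr₁ hr₂ (k := n) (by rw [hlen]; push_cast; ring)
    refine (hL L₁ L₂ e h h' hLe n).2 ?_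
    rw [hh, h1, bar_mul (W (-e) ^ n), map_mul (toM S) (z.bar * y).bar, ← mul_assoc, toM_mul_bar hy₁, one_mul]
  · have h1 := hst.prefix_eq hr₂ hr₁ (k := n) (by rw [hlen]; push_cast; ring)
    refine (hL L₁ L₂ e h h' hLe n).1 ?_
    rw [hh, h1, map_mul (toM S) (W (-e) ^ n), mul_assoc, toM_mul_bar hy₂, mul_one]

theorem Form.relator_mem (hC : IsConvex C) {W : ℤˣ → Word (Letters S)} {α : ZT}
    (hst : IsStable C s W α) {m : MonM S} {L : List (ℤˣ × MonM S)} (hL : NoPinch W L)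
    {p u q : Word (Letters S)} {f : List (Letters S)} (hu : GReduced u) (hf : eval S f = 1)
    (h : Form C s m L (p * (u * ofList f * u.bar * q))) : u.len ∈ C := by
  have h' : Form C s m L (p * u * (ofList f * (u.bar * q))) := by
    simpa only [mul_assoc] using h
  rcases h'.locate hC hst.len_not_mem hst.reduced with
    h1 | h1 | ⟨A, σ₁, σ₂, B, h1, h2, h3, h4, h5⟩ | h1
  · exact hC.right h1
  · exact hC.left (x := u.bar) (hC.right h1)
  · obtain ⟨σ₃, rfl, h6, h7⟩ := hC.prefix h2 (hC.ofList f) h4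
    obtain rfl : f = [] := by
      rw [← mul_assoc] at h5
      exact h5.list_eq_nil hf
    rw [ofList_nil, one_mul] at h5
    by_contra hnu
    have hu1 : u ≠ 1 := by
      rintro rfl
      exact hnu one_len_mem
    -- The last letter c of u and its inverse at the start of ū both lie in the reduced word σ₁ σ₂,
    -- next to each other.
    obtain ⟨u', c, rfl⟩ := exists_last hu1
    have hc : (single c).len ∈ C := hC.one_mem
    rw [bar_mul, mul_assoc] at h6
    obtain ⟨σ₄, rfl, -⟩ := hC.prefix h6 hc h7
    have h8 : (single c).bar * (p * u').bar = σ₁.bar * A.bar := by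
      rw [← bar_mul, ← bar_mul, ← h1, mul_assoc]
    obtain ⟨σ₅, h9, -⟩ := hC.prefix h8 hc h3
    have h10 : σ₁ = σ₅.bar * single c := by
      rw [← bar_bar σ₁, h9, bar_mul, bar_bar]
    rw [h10, mul_assoc, ← mul_assoc (single c)] at h5
    have h11 := h5.right.left.mul_bar
    have := congrArg len h11
    exact ZT.zero_lt_one.ne' this
  · exact h1.relator_mem hC hst hL hu hf

/-- Induction over the insertions, read backwards: the relator inserted last is short, its deletion
leaves a word of the same form, and the empty word has no room for a core. -/
theorem Form.not_null (hC : IsConvex C) {W : ℤˣ → Word (Letters S)} {α : ZT}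
    (hst : IsStable C s W α) {m : MonM S} {L : List (ℤˣ × MonM S)} (hL : NoPinch W L)
    (hL0 : L ≠ []) {Y : Word (Letters S)} (h : Form C s m L Y) : ¬ Null Y := by
  intro hN
  induction hN with
  | one =>
    cases L with
    | nil => exact hL0 rfl
    | cons eh L =>
      obtain ⟨e, h'⟩ := eh
      obtain ⟨g, σ, Y', x, z, h1, h2, hg, hx, hz, h3, h4⟩ := h
      have hσ := core_not_mem hst.len_not_mem h2 hx hz
      rw [mul_eq_one_left (mul_eq_one_right h1.symm)] at hσ
      exact hσ one_len_mem
  | ins p q u f hN hu hf ih =>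
    rw [mul_assoc] at h
    have hm := h.relator_mem hC hst hL hu hf
    exact ih (h.delete hC hst.len_not_mem hst.reduced
      (mul_len_mem (mul_len_mem hm (hC.ofList f)) hm) ⟨u, f, hu, hf, rfl⟩)

end forms

/-! ### Scales in ℤ[t] and periodic extensions of words -/

open Word

/-- The data used to build the word for the stable letter: `B` is the convex subgroup generated by
`α`, with a retraction `tr` onto it, `C` is a larger convex subgroup with the coefficient `cf` of
its leading term `τ`, and `T` lies above `C`. -/
structure Scale (α : ZT) (B C : AddSubgroup ZT) (tr : ZT →+ ZT) (cf : ZT →+ ℤ) (τ T : ZT) :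
    Prop where
  convB : IsConvex B
  convC : IsConvex C
  le : B ≤ C
  pos : 0 < α
  mem : α ∈ B
  arch : ∀ β ∈ B, ∃ n : ℕ, β < n * α
  tr_mem : ∀ β, tr β ∈ B
  tr_id : ∀ β ∈ B, tr β = β
  -- With this, the reflection β ↦ T - β of positions becomes negation after truncation.
  tr_top : tr T = 0
  top_pos : 0 < T
  top_not_mem : T ∉ C
  τ_mem : τ ∈ C
  cf_τ : cf τ = 1
  cf_B : ∀ β ∈ B, cf β = 0
  cf_pos : ∀ β ∈ C, 0 < cf β → 0 < β

section periodic

variable {Γ : Type*}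

open Classical in
/-- The periodic extension of a word to the convex subgroup generated by its length. -/
noncomputable def per (x : Word Γ) (β : ZT) : Option Γ :=
  if h : ∃ k : ℤ, 1 ≤ β - k * x.len ∧ β - k * x.len ≤ x.len then
    x.letter (β - h.choose * x.len) else none

theorem period_unique {α β : ZT} {k k' : ℤ} (h1 : 1 ≤ β - k * α) (h2 : β - k * α ≤ α)
    (h1' : 1 ≤ β - k' * α) (h2' : β - k' * α ≤ α) : k = k' := by
  have hα : 0 < α := ZT.pos_iff.2 (h1.trans h2)
  have key : ∀ {m n : ℤ}, 1 ≤ β - m * α → β - n * α ≤ α → m ≤ n := by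
    intro m n h1 h2
    by_contra h
    have h3 : (n : ZT) + 1 ≤ m := by exact_mod_cast not_le.1 h
    have h4 := mul_le_mul_of_nonneg_right h3 hα.le
    have := ZT.zero_lt_one
    linarith
  exact le_antisymm (key h1 h2') (key h1' h2)

theorem per_eq {x : Word Γ} {β : ZT} {k : ℤ} (h1 : 1 ≤ β - k * x.len)
    (h2 : β - k * x.len ≤ x.len) : per x β = x.letter (β - k * x.len) := by
  have h : ∃ k : ℤ, 1 ≤ β - k * x.len ∧ β - k * x.len ≤ x.len := ⟨k, h1, h2⟩
  rw [per, dif_pos h, period_unique h.choose_spec.1 h.choose_spec.2 h1 h2]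

theorem per_of_mem {x : Word Γ} {β : ZT} (h1 : 1 ≤ β) (h2 : β ≤ x.len) :
    per x β = x.letter β := by
  have := per_eq (x := x) (β := β) (k := 0) (by simpa using h1) (by simpa using h2)
  simpa using this

theorem per_eq_none {x : Word Γ} {β : ZT}
    (h : ¬ ∃ k : ℤ, 1 ≤ β - k * x.len ∧ β - k * x.len ≤ x.len) : per x β = none := dif_neg h

theorem per_add_mul (x : Word Γ) (β : ZT) (j : ℤ) : per x (β + j * x.len) = per x β := by
  by_cases h : ∃ k : ℤ, 1 ≤ β - k * x.len ∧ β - k * x.len ≤ x.len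
  · obtain ⟨k, h1, h2⟩ := h
    have e : β + j * x.len - ((k + j : ℤ) : ZT) * x.len = β - k * x.len := by push_cast; ring
    rw [per_eq h1 h2, per_eq (k := k + j) (by rwa [e]) (by rwa [e]), e]
  · rw [per_eq_none h, per_eq_none]
    rintro ⟨k, h1, h2⟩
    have e : β - ((k - j : ℤ) : ZT) * x.len = β + j * x.len - k * x.len := by push_cast; ring
    exact h ⟨k - j, by rwa [e], by rwa [e]⟩

theorem per_bar [InvolutiveInv Γ] (x : Word Γ) (β : ZT) :
    (per x (1 - β)).map (fun a => a⁻¹) = per x.bar β := by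
  by_cases h : ∃ k : ℤ, 1 ≤ β - k * x.len ∧ β - k * x.len ≤ x.len
  · obtain ⟨k, h1, h2⟩ := h
    have e : 1 - β - ((-k - 1 : ℤ) : ZT) * x.len = x.len + 1 - (β - k * x.len) := by
      push_cast; ring
    rw [per_eq (x := x.bar) (k := k) h1 h2, per_eq (k := -k - 1) (by rw [e]; linarith)
      (by rw [e]; linarith), e]
    rfl
  · rw [per_eq_none (x := x.bar) h, per_eq_none]
    · rfl
    · rintro ⟨k, h1, h2⟩
      have e : β - ((-k - 1 : ℤ) : ZT) * x.len = x.len + 1 - (1 - β - k * x.len) := by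
        push_cast; ring
      exact h ⟨-k - 1, by rw [e]; linarith, by rw [e]; linarith⟩

theorem letter_pow (x : Word Γ) (k : ℕ) {β : ZT} (h1 : 1 ≤ β) (h2 : β ≤ k * x.len) :
    (x ^ k).letter β = per x β := by
  induction k generalizing β with
  | zero =>
    have := ZT.zero_lt_one
    rw [Nat.cast_zero, zero_mul] at h2
    linarith
  | succ k ih =>
    rw [pow_succ']
    by_cases h : β ≤ x.len
    · rw [letter_mul_of_le _ _ h, per_of_mem h1 h]
    · rw [letter_mul_of_lt _ _ (not_le.1 h), ih (ZT.pos_iff.1 (sub_pos.2 (not_le.1 h)))]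
      · have := per_add_mul x (β - x.len) 1
        rw [← this]
        congr 1
        push_cast; ring
      · push_cast at h2
        linarith

end periodic

/-! ### The word for the stable letter and its rigidity -/

section scale

variable {α : ZT} {B C : AddSubgroup ZT} {tr : ZT →+ ZT} {cf : ZT →+ ℤ} {τ T : ZT}

theorem Scale.exists_period (hc : Scale α B C tr cf τ T) {β : ZT} (hβ : β ∈ B) :
    ∃ k : ℤ, 1 ≤ β - k * α ∧ β - k * α ≤ α := by
  obtain ⟨n, hn⟩ := hc.arch β hβ
  obtain ⟨m, hm⟩ := hc.arch (-β) (B.neg_mem hβ)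
  have hα := hc.pos
  obtain ⟨k, hk, hmax⟩ := Int.exists_greatest_of_bdd (P := fun k : ℤ => (k : ZT) * α < β)
    ⟨n, fun z hz => by
      by_contra h
      have h3 : (n : ZT) ≤ z := by exact_mod_cast (not_le.1 h).le
      have h4 := mul_le_mul_of_nonneg_right h3 hα.le
      linarith⟩ ⟨-m, by push_cast; linarith⟩
  refine ⟨k, ZT.pos_iff.1 (sub_pos.2 hk), ?_⟩
  by_contra h
  have := hmax (k + 1) (by push_cast; linarith)
  omega

theorem Scale.one_le (hc : Scale α B C tr cf τ T) : 1 ≤ α := ZT.pos_iff.1 hc.pos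

theorem Scale.tr_add (hc : Scale α B C tr cf τ T) (β : ZT) {i : ZT} (hi : i ∈ B) :
    tr (β + i) = tr β + i := by rw [map_add, hc.tr_id i hi]

theorem Scale.exists_factor (hc : Scale α B C tr cf τ T) {Γ : Type*} {x z : Word Γ}
    (hx : x.len = α) {δ : ZT} (hδ : δ ∈ B) {k : ℕ} (hk : α + z.len ≤ k * α)
    (h : ∀ j, 1 ≤ j → j ≤ z.len → z.letter j = per x (δ + j)) :
    ∃ p q : Word Γ, x ^ k = p * z * q ∧ p.len < α ∧ ∃ m : ℤ, p.len = δ - m * α := by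
  -- Positions start at 1, so δ + 1 is reduced modulo α; the offset δ - mα then satisfies 0 ≤ δ - mα
  -- < α.
  obtain ⟨m, h1, h2⟩ := hc.exists_period (B.add_mem hδ hc.convB.one_mem)
  have h0 := ZT.zero_lt_one
  have hz := z.len_nonneg
  have hl : (x ^ k).len = k * α := by rw [len_pow, hx]
  obtain ⟨p, r, hpr, hp⟩ := exists_split (x ^ k) (κ := δ - m * α) (by linarith)
    (by rw [hl]; linarith)
  have hr : r.len = k * α - (δ - m * α) := by
    rw [hpr, len_mul, hp] at hl
    linarith
  obtain ⟨z', q, rfl, hz'⟩ := exists_split r (κ := z.len) hz (by rw [hr]; linarith)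
  have hzz : z' = z := by
    refine ext_letter hz' fun j hj1 hj2 => ?_
    rw [hz'] at hj2
    rw [h j hj1 hj2, ← letter_mul_of_le z' q (hj2.trans hz'.ge),
      ← letter_mul_add p _ (ZT.pos_iff.2 hj1), ← hpr, letter_pow _ _ (by linarith)
      (by rw [hx]; linarith), ← per_add_mul x _ m, hx, hp]
    congr 1
    ring
  subst hzz
  exact ⟨p, q, by rw [hpr, mul_assoc], by linarith, m, hp⟩

/-- A period of y is visible in the periodic line of x, so y occurs in x x and starts within the
first period. This is what the definition of primitivity can be applied to. -/
theorem Scale.exists_occurrence (hc : Scale α B C tr cf τ T) {Γ : Type*} {x y : Word Γ}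
    (hx : x.len = α) (hy : y.len = α) {δ : ZT} (hδ : δ ∈ B)
    (h : ∀ i ∈ B, per x i = per y (i + δ)) :
    ∃ p q : Word Γ, x * x = p * y * q ∧ p.len < α ∧ ∃ m : ℤ, p.len = -δ - m * α := by
  rw [← sq]
  refine hc.exists_factor hx (B.neg_mem hδ) (by rw [hy]; push_cast; linarith) fun j h1 h2 => ?_
  have hj : j ∈ B := hc.convB.mem_of_le (ZT.pos_iff.2 h1).le (h2.trans hy.le) hc.mem
  rw [h _ (B.add_mem (B.neg_mem hδ) hj), ← per_of_mem h1 h2]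
  congr 1
  ring

theorem Scale.period_of_primitive (hc : Scale α B C tr cf τ T) {Γ : Type*} [Inv Γ] {w : Word Γ}
    (hw : w.len = α) (hp : w.Primitive) {δ : ZT} (hδ : δ ∈ B)
    (h : ∀ i ∈ B, per w i = per w (i + δ)) : ∃ k : ℤ, δ = k * α := by
  obtain ⟨p, q, h1, h2, m, h3⟩ := hc.exists_occurrence hw hw hδ h
  have hl := congrArg len h1
  simp only [len_mul, hw] at hl
  rcases hp.2.1 p q h1 with rfl | rfl
  · refine ⟨-m, ?_⟩
    rw [len_one] at h3
    push_cast
    linarith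
  · rw [len_one] at hl
    linarith

theorem Scale.not_primitive (hc : Scale α B C tr cf τ T) {Γ : Type*} [InvolutiveInv Γ]
    {w : Word Γ} (hw : w.len = α) (hp : w.Primitive) {δ : ZT} (hδ : δ ∈ B)
    (h : ∀ i ∈ B, per w i = per w.bar (i + δ)) : False := by
  obtain ⟨p, q, h1, -⟩ := hc.exists_occurrence hw hw hδ (y := w.bar) h
  exact hp.2.2 p q h1

theorem Word.Primitive.bar {Γ : Type*} [InvolutiveInv Γ] {w : Word Γ} (h : w.Primitive) :
    w.bar.Primitive := by
  refine ⟨fun h1 => h.1 (bar_eq_one.1 h1), fun p q h1 => ?_, fun p q h1 => ?_⟩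
  · have h2 := congrArg Word.bar h1
    simp only [bar_mul, bar_bar, ← mul_assoc] at h2
    rcases h.2.1 _ _ h2 with h3 | h3
    · exact Or.inr (bar_eq_one.1 h3)
    · exact Or.inl (bar_eq_one.1 h3)
  · have h2 := congrArg Word.bar h1
    simp only [bar_mul, bar_bar, ← mul_assoc] at h2
    exact h.2.2 _ _ h2

/-- The positions near `2 ^ k τ` or `T - 2 ^ k τ`, at which the word `w` is replaced by `w̄`. -/
def Marked (B : AddSubgroup ZT) (τ T β : ZT) : Prop :=
  ∃ k : ℕ, β - (2 ^ k : ℕ) • τ ∈ B ∨ T - β - (2 ^ k : ℕ) • τ ∈ B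

theorem marked_add {i : ZT} (hi : i ∈ B) (β : ZT) :
    Marked B τ T (β + i) ↔ Marked B τ T β := by
  refine exists_congr fun k => or_congr ?_ ?_
  · rw [add_sub_right_comm]
    exact B.add_mem_cancel_right hi
  · rw [show T - (β + i) - (2 ^ k : ℕ) • τ = T - β - (2 ^ k : ℕ) • τ - i by ring, sub_eq_add_neg]
    exact B.add_mem_cancel_right (B.neg_mem hi)

theorem marked_sub (β : ZT) : Marked B τ T (T - β) ↔ Marked B τ T β := by
  refine exists_congr fun k => ?_
  rw [sub_sub_cancel]
  exact or_comm

/-- Marks coming from the far end T are at distance beyond C. -/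
theorem Scale.marked_iff (hc : Scale α B C tr cf τ T) {β : ZT} (hβ : β ∈ C) :
    Marked B τ T β ↔ ∃ k : ℕ, β - (2 ^ k : ℕ) • τ ∈ B := by
  refine exists_congr fun k => or_iff_left fun h => hc.top_not_mem ?_
  have := C.add_mem (hc.le h) (C.add_mem hβ (C.nsmul_mem hc.τ_mem (2 ^ k)))
  rwa [show T - β - (2 ^ k : ℕ) • τ + (β + (2 ^ k : ℕ) • τ) = T by ring] at this

open Classical in
/-- The letters of `x` are arranged periodically near all positions in `C`, except for the marked
positions, where `x̄` is used. -/
def IsPattern {Γ : Type*} [Inv Γ] (B C : AddSubgroup ZT) (tr : ZT →+ ZT) (τ T : ZT)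
    (y x : Word Γ) : Prop :=
  ∀ β ∈ C, β ∉ B → 0 < β → y.letter β = per (if Marked B τ T β then x.bar else x) (tr β)

open Classical in
-- A shift by γ carries the coset c + B onto c + γ + B. If c has large leading coefficient, both
-- cosets lie in the range of agreement, so the whole periodic lines written on them agree up to `tr
-- γ`.
theorem Scale.per_shift (hc : Scale α B C tr cf τ T) {Γ : Type*} [Inv Γ] {y x y' x' : Word Γ}
    (hy : IsPattern B C tr τ T y x) (hy' : IsPattern B C tr τ T y' x') {γ : ZT} (hγ : γ ∈ C)
    (h : ShiftEq C y y' γ) : ∃ M : ℕ, ∀ c ∈ C, (M : ℤ) < cf c → 0 < cf c + cf γ ∧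
      ∀ i ∈ B, per (if Marked B τ T c then x.bar else x) i =
        per (if Marked B τ T (c + γ) then x'.bar else x') (i + tr γ) := by
  obtain ⟨β₀, hβ₀, h⟩ := h
  refine ⟨(cf γ).natAbs + (cf β₀).natAbs, fun c hcC hM => ?_⟩
  have hcγ : 0 < cf c + cf γ := by omega
  refine ⟨hcγ, fun i hi => ?_⟩
  -- The displacement i - `tr c` leads to the position of c + B whose truncation is i.
  have hj : i - tr c ∈ B := B.sub_mem hi (hc.tr_mem c)
  have hjC := hc.le hj
  have e1 : cf (c + (i - tr c)) = cf c := by rw [map_add, hc.cf_B _ hj, add_zero]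
  have e2 : cf (c + γ + (i - tr c)) = cf c + cf γ := by
    rw [map_add, map_add, hc.cf_B _ hj, add_zero]
  have m1 : c + (i - tr c) ∈ C := C.add_mem hcC hjC
  have m2 : c + γ + (i - tr c) ∈ C := C.add_mem (C.add_mem hcC hγ) hjC
  have h0 : β₀ ≤ c + (i - tr c) := by
    refine (sub_pos.1 (hc.cf_pos _ (C.sub_mem m1 hβ₀) ?_)).le
    rw [map_sub, e1]
    omega
  have h1 := h _ m1 h0
  rw [show c + (i - tr c) + γ = c + γ + (i - tr c) by ring,
    hy _ m1 (fun hB => by have := hc.cf_B _ hB; omega) (hc.cf_pos _ m1 (by omega)),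
    hy' _ m2 (fun hB => by have := hc.cf_B _ hB; omega) (hc.cf_pos _ m2 (by omega)),
    hc.tr_add _ hj, hc.tr_add _ hj, map_add] at h1
  simp only [marked_add hj] at h1
  rw [show tr c + (i - tr c) = i by ring, show tr c + tr γ + (i - tr c) = i + tr γ by ring] at h1
  exact h1

/-- A mark 2^k τ far out carries w̄. Its translate by γ is marked as well, since otherwise w and w̄
would have the same periodic line. Far out the gaps between marks exceed the leading coefficient of
γ, so the mark is sent to itself and γ ∈ B. Primitivity then puts γ in ℤα. -/
theorem Scale.shift_same (hc : Scale α B C tr cf τ T) {Γ : Type*} [InvolutiveInv Γ]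
    {y w : Word Γ} (hy : IsPattern B C tr τ T y w) (hw : w.len = α) (hp : w.Primitive) {γ : ZT}
    (hγ : γ ∈ C) (h : ShiftEq C y y γ) : ∃ k : ℤ, γ = k * α := by
  obtain ⟨M, hM⟩ := hc.per_shift hy hy hγ h
  -- The nearest other power of 2 has distance 2^(k-1) from 2^k, so twice the absolute value of `cf
  -- γ` must stay below 2^k.
  obtain ⟨k, hk⟩ : ∃ k : ℕ, M + 2 * (cf γ).natAbs < 2 ^ k :=
    ⟨_, Nat.lt_two_pow_self⟩
  have hcC : (2 ^ k : ℕ) • τ ∈ C := C.nsmul_mem hc.τ_mem _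
  have hcf : ∀ n : ℕ, cf (n • τ) = n := fun n => by rw [map_nsmul, hc.cf_τ]; simp
  obtain ⟨h1, h2⟩ := hM _ hcC (by rw [hcf]; omega)
  rw [if_pos ((hc.marked_iff hcC).2 ⟨k, by rw [sub_self]; exact B.zero_mem⟩)] at h2
  by_cases hm : Marked B τ T ((2 ^ k : ℕ) • τ + γ)
  · obtain ⟨j, hj⟩ := (hc.marked_iff (C.add_mem hcC hγ)).1 hm
    have h3 := hc.cf_B _ hj
    rw [map_sub, map_add, hcf, hcf] at h3
    have hjk : j = k := by
      rcases lt_trichotomy j k with h4 | h4 | h4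
      · have h5 : 2 ^ (j + 1) ≤ 2 ^ k := Nat.pow_le_pow_right two_pos h4
        rw [pow_succ] at h5
        omega
      · exact h4
      · have h5 : 2 ^ (k + 1) ≤ 2 ^ j := Nat.pow_le_pow_right two_pos h4
        rw [pow_succ] at h5
        omega
    subst hjk
    rw [add_sub_cancel_left] at hj
    rw [if_pos hm, hc.tr_id γ hj] at h2
    exact hc.period_of_primitive (w := w.bar) hw hp.bar hj h2
  · rw [if_neg hm] at h2
    refine (hc.not_primitive (w := w.bar) hw hp.bar (hc.tr_mem γ) fun i hi => ?_).elim
    rw [bar_bar]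
    exact h2 i hi

theorem Scale.not_shift (hc : Scale α B C tr cf τ T) {Γ : Type*} [InvolutiveInv Γ]
    {y y' w : Word Γ} (hy : IsPattern B C tr τ T y w) (hy' : IsPattern B C tr τ T y' w.bar)
    (hw : w.len = α) (hp : w.Primitive) {γ : ZT} (hγ : γ ∈ C) : ¬ ShiftEq C y y' γ := by
  intro h
  obtain ⟨M, hM⟩ := hc.per_shift hy hy' hγ h
  obtain ⟨k, hk⟩ : ∃ k : ℕ, M + 2 * (cf γ).natAbs < 2 ^ k :=
    ⟨_, Nat.lt_two_pow_self⟩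
  -- The number 3 · 2^k is the midpoint of 2^(k+1) and 2^(k+2), so neither this position nor its
  -- translate by γ is marked, and w would be compared with w̄.
  have hcC : (3 * 2 ^ k : ℕ) • τ ∈ C := C.nsmul_mem hc.τ_mem _
  have hcf : ∀ n : ℕ, cf (n • τ) = n := fun n => by rw [map_nsmul, hc.cf_τ]; simp
  obtain ⟨h1, h2⟩ := hM _ hcC (by rw [hcf]; omega)
  have key : ∀ δ ∈ C, (cf δ).natAbs ≤ (cf γ).natAbs →
      ¬ Marked B τ T ((3 * 2 ^ k : ℕ) • τ + δ) := by
    intro δ hδ hle hm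
    obtain ⟨j, hj⟩ := (hc.marked_iff (C.add_mem hcC hδ)).1 hm
    have h3 := hc.cf_B _ hj
    rw [map_sub, map_add, hcf, hcf] at h3
    rcases le_or_gt j (k + 1) with h4 | h4
    · have h5 : 2 ^ j ≤ 2 ^ (k + 1) := Nat.pow_le_pow_right two_pos h4
      rw [pow_succ] at h5
      omega
    · have h5 : 2 ^ (k + 2) ≤ 2 ^ j := Nat.pow_le_pow_right two_pos h4
      rw [pow_succ, pow_succ] at h5
      omega
  have k0 := key 0 C.zero_mem (by simp)
  rw [add_zero] at k0
  rw [if_neg k0, if_neg (key γ hγ le_rfl)] at h2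
  exact hc.not_primitive hw hp (hc.tr_mem γ) h2

open Classical in
/-- The word which is repeated near a position of the stable letter. -/
noncomputable def select {Γ : Type*} [Inv Γ] (B : AddSubgroup ZT) (τ T : ZT) (u v w : Word Γ)
    (β : ZT) : Word Γ :=
  if β ∈ B then u else if T - β ∈ B then v else if Marked B τ T β then w.bar else w

theorem select_add {Γ : Type*} [Inv Γ] {u v w : Word Γ} {i : ZT} (hi : i ∈ B) (β : ZT) :
    select B τ T u v w (β + i) = select B τ T u v w β := by
  have h1 : T - (β + i) ∈ B ↔ T - β ∈ B := by
    rw [← sub_sub, sub_eq_add_neg]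
    exact B.add_mem_cancel_right (B.neg_mem hi)
  classical exact if_congr (B.add_mem_cancel_right hi) rfl (if_congr h1 rfl (if_congr (marked_add hi β) rfl rfl))

theorem len_select {Γ : Type*} [InvolutiveInv Γ] {u v w : Word Γ} (hu : u.len = α)
    (hv : v.len = α) (hw : w.len = α) (β : ZT) : (select B τ T u v w β).len = α := by
  rw [select]
  split_ifs <;> assumption

open Classical in
/-- The word for the stable letter. -/
noncomputable def Scale.word (hc : Scale α B C tr cf τ T) {Γ : Type*} [InvolutiveInv Γ]
    {u v w : Word Γ} (hu : u.len = α) (hv : v.len = α) (hw : w.len = α) : Word Γ where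
  len := T
  len_nonneg := hc.top_pos.le
  letter β := if 1 ≤ β ∧ β ≤ T then per (select B τ T u v w β) (tr β) else none
  isSome_iff β := by
    split_ifs with h
    · have hl := len_select (B := B) (τ := τ) (T := T) hu hv hw β
      obtain ⟨k, h1, h2⟩ := hc.exists_period (hc.tr_mem β)
      rw [← hl] at h1 h2
      rw [per_eq h1 h2, isSome_iff]
      tauto
    · simpa using h

variable {Γ : Type*} [InvolutiveInv Γ] {u v w : Word Γ}

theorem Scale.letter_word (hc : Scale α B C tr cf τ T) (hu : u.len = α) (hv : v.len = α)
    (hw : w.len = α) {β : ZT} (h1 : 1 ≤ β) (h2 : β ≤ T) :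
    (hc.word hu hv hw).letter β = per (select B τ T u v w β) (tr β) := if_pos ⟨h1, h2⟩

theorem Scale.lt_top (hc : Scale α B C tr cf τ T) {β : ZT} (h : β ∈ C) : β < T :=
  hc.convC.lt h hc.top_not_mem hc.top_pos.le

theorem Scale.sub_not_mem (hc : Scale α B C tr cf τ T) {β : ZT} (h : β ∈ C) : T - β ∉ C :=
  fun h1 => hc.top_not_mem (by simpa using C.add_mem h1 h)

theorem Scale.isPattern (hc : Scale α B C tr cf τ T) (hu : u.len = α) (hv : v.len = α)
    (hw : w.len = α) : IsPattern B C tr τ T (hc.word hu hv hw) w := by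
  intro β hβ hB h0
  rw [hc.letter_word hu hv hw (ZT.pos_iff.1 h0) (hc.lt_top hβ).le, select, if_neg hB,
    if_neg fun h => hc.sub_not_mem hβ (hc.le h)]

theorem Scale.isPattern_bar (hc : Scale α B C tr cf τ T) (hu : u.len = α) (hv : v.len = α)
    (hw : w.len = α) : IsPattern B C tr τ T (hc.word hu hv hw).bar w.bar := by
  intro β hβ hB h0
  change ((hc.word hu hv hw).letter (T + 1 - β)).map (fun a => a⁻¹) = _
  have h1 : 1 ≤ β := ZT.pos_iff.1 h0
  -- The involution sends β to T + 1 - β. The marks are symmetric under β ↦ T - β, and the extra 1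
  -- is the one in `per_bar`.
  rw [hc.letter_word hu hv hw (by linarith [hc.lt_top hβ]) (by linarith),
    show T + 1 - β = T - β + 1 by ring, select_add hc.convB.one_mem,
    hc.tr_add _ hc.convB.one_mem, map_sub, hc.tr_top, show 0 - tr β + 1 = 1 - tr β by ring, per_bar,
    select, if_neg fun h => hc.sub_not_mem hβ (hc.le h), sub_sub_cancel, if_neg hB]
  by_cases hm : Marked B τ T β
  · rw [if_pos hm, if_pos ((marked_sub β).2 hm)]
  · rw [if_neg hm, if_neg (mt (marked_sub β).1 hm)]

/-- Moving by α keeps the coset of B and the periodic line on it. The first α letters of u s are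
those of u by the choice on B, and the last α letters of s v are those of v by the choice on T + B.
-/
theorem Scale.word_comm (hc : Scale α B C tr cf τ T) (hu : u.len = α) (hv : v.len = α)
    (hw : w.len = α) : u * hc.word hu hv hw = hc.word hu hv hw * v := by
  have hl : (hc.word hu hv hw).len = T := rfl
  have hαT : α < T := hc.lt_top (hc.le hc.mem)
  have h0 := hc.pos
  refine ext_letter (by rw [len_mul, len_mul, hu, hv, add_comm]) fun β h1 h2 => ?_
  rw [len_mul, hu, hl] at h2
  have hsel : select B τ T u v w (β - α) = select B τ T u v w β := by
    have := select_add (τ := τ) (T := T) (u := u) (v := v) (w := w) hc.mem (β - α)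
    rw [← this, sub_add_cancel]
  by_cases hα : β ≤ α
  · have hB : β ∈ B := hc.convB.mem_of_le (ZT.pos_iff.2 h1).le hα hc.mem
    rw [letter_mul_of_le _ _ (hu ▸ hα), letter_mul_of_le _ _ (by rw [hl]; linarith),
      hc.letter_word hu hv hw h1 (by linarith), select, if_pos hB, hc.tr_id _ hB,
      per_of_mem h1 (hu ▸ hα)]
  · have hα := not_le.1 hα
    rw [letter_mul_of_lt _ _ (hu ▸ hα), hu, hc.letter_word hu hv hw
      (ZT.pos_iff.1 (sub_pos.2 hα)) (by linarith), hsel, map_sub, hc.tr_id _ hc.mem]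
    have hs := len_select (B := B) (τ := τ) (T := T) hu hv hw β
    have hper := per_add_mul (select B τ T u v w β) (tr β) (-1)
    rw [hs, show tr β + ((-1 : ℤ) : ZT) * α = tr β - α by push_cast; ring] at hper
    rw [hper]
    by_cases hT : β ≤ T
    · rw [letter_mul_of_le _ _ (hT.trans hl.ge), hc.letter_word hu hv hw h1 hT]
    · have hT := not_le.1 hT
      have hB : β - T ∈ B := hc.convB.mem_of_le (sub_pos.2 hT).le (by linarith) hc.mem
      have hB' : T - β ∈ B := by simpa using B.neg_mem hB
      have hnB : β ∉ B := fun h => hc.top_not_mem (hc.le (by simpa using B.add_mem hB' h))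
      have htr : tr β = β - T := by
        rw [← hc.tr_id _ hB, map_sub, hc.tr_top, sub_zero]
      rw [letter_mul_of_lt _ _ (hl.trans_lt hT), hl, select, if_neg hnB, if_pos hB', htr,
        per_of_mem (ZT.pos_iff.1 (sub_pos.2 hT)) (by rw [hv]; linarith)]

end scale

section reduced

variable {G : Type*} [Group G] {S : Set G}
variable {α : ZT} {B C : AddSubgroup ZT} {tr : ZT →+ ZT} {cf : ZT →+ ℤ} {τ T : ZT}
variable {u v w : Word (Letters S)}

theorem CyclicallyGReduced.bar {x : Word (Letters S)} (h : CyclicallyGReduced x) :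
    CyclicallyGReduced x.bar := fun k => by
  rw [← bar_pow]
  exact (h k).bar

/-- A finite factor stays within one coset of B, hence is a factor of a power of u, v, w or w̄, and
these words are cyclically reduced. -/
theorem Scale.word_reduced (hc : Scale α B C tr cf τ T) (hu : u.len = α) (hv : v.len = α)
    (hw : w.len = α) (cu : CyclicallyGReduced u) (cv : CyclicallyGReduced v)
    (cw : CyclicallyGReduced w) : GReduced (hc.word hu hv hw) := by
  intro p q l h hl
  have hs := len_select (B := B) (τ := τ) (T := T) hu hv hw p.len
  have hsel : CyclicallyGReduced (select B τ T u v w p.len) := by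
    rw [select]
    split_ifs
    exacts [cu, cv, cw.bar, cw]
  have hlen : T = p.len + (ofList l).len + q.len := congrArg len h
  have hq := q.len_nonneg
  have hp := p.len_nonneg
  obtain ⟨p', q', h1, -⟩ := hc.exists_factor (z := ofList l) hs (hc.tr_mem p.len)
    (k := l.length + 1) (by
      rw [len_ofList]
      have h2 := mul_le_mul_of_nonneg_left hc.one_le (Nat.cast_nonneg (α := ZT) l.length)
      push_cast
      linarith)
    (fun j h1 h2 => by
      have hj : j ∈ B := hc.convB.mem_of_le (ZT.pos_iff.2 h1).le h2 (hc.convB.ofList l)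
      have h3 : (hc.word hu hv hw).letter (p.len + j) = (ofList l).letter j := by
        rw [h, mul_assoc, add_comm, letter_mul_add _ _ (ZT.pos_iff.2 h1), letter_mul_of_le _ _ h2]
      rw [← h3, hc.letter_word hu hv hw (by linarith) (by linarith), select_add hj,
        hc.tr_add _ hj])
  exact hsel _ p' q' l h1 hl

theorem Scale.isStable (hc : Scale α B C tr cf τ T) (hu : u.len = α) (hv : v.len = α)
    (hw : w.len = α) (cu : CyclicallyGReduced u) (cv : CyclicallyGReduced v)
    (cw : CyclicallyGReduced w) (hp : w.Primitive) :
    IsStable C (hc.word hu hv hw) (fun e => if e = 1 then u else v.bar) α where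
  len_not_mem := hc.top_not_mem
  reduced := hc.word_reduced hu hv hw cu cv cw
  len_W e := by
    split_ifs
    exacts [hu, hv]
  comm e := by
    have h := hc.word_comm hu hv hw
    rcases Int.units_eq_one_or e with rfl | rfl
    · rw [signed_one, if_pos rfl, if_neg (by decide), bar_bar, h]
    · rw [signed_neg_one, if_neg (by decide), neg_neg, if_pos rfl, ← bar_mul, ← bar_mul, h]
  shift e e' γ hγ h := by
    have h1 := hc.isPattern hu hv hw
    have h2 := hc.isPattern_bar hu hv hw
    rcases Int.units_eq_one_or e with rfl | rfl <;> rcases Int.units_eq_one_or e' with rfl | rfl <;>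
      simp only [signed_one, signed_neg_one] at h
    · exact ⟨rfl, hc.shift_same h1 hw hp hγ h⟩
    · exact (hc.not_shift h1 h2 hw hp hγ h).elim
    · exact (hc.not_shift (w := w.bar) h2 (by rwa [bar_bar]) hw hp.bar hγ h).elim
    · exact ⟨rfl, hc.shift_same h2 hw hp.bar hγ h⟩

end reduced

/-! ### Convex subgroups of ℤ[t] given by the degree -/

section coefficients

/-- The `i`-th coefficient. -/
noncomputable def ZT.coeff (i : ℕ) : ZT →+ ℤ where
  toFun a := Polynomial.coeff (R := ℤ) a i
  map_zero' := Polynomial.coeff_zero i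
  map_add' a b := Polynomial.coeff_add (R := ℤ) a b i

theorem ZT.ext_coeff {a b : ZT} (h : ∀ i, ZT.coeff i a = ZT.coeff i b) : a = b :=
  Polynomial.ext (R := ℤ) h

/-- The polynomials of degree less than `n`. -/
noncomputable def ZT.low (n : ℕ) : AddSubgroup ZT where
  carrier := {a | ∀ i, n ≤ i → ZT.coeff i a = 0}
  zero_mem' i _ := map_zero _
  add_mem' {a b} ha hb i hi := by rw [map_add, ha i hi, hb i hi, add_zero]
  neg_mem' {a} ha i hi := by rw [map_neg, ha i hi, neg_zero]

theorem ZT.low_mono {m n : ℕ} (h : m ≤ n) : ZT.low m ≤ ZT.low n :=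
  fun _ ha i hi => ha i (h.trans hi)

theorem ZT.exists_mem_low (a : ZT) : ∃ n, a ∈ ZT.low n :=
  ⟨Polynomial.natDegree (R := ℤ) a + 1, fun _ hi =>
    Polynomial.coeff_eq_zero_of_natDegree_lt (R := ℤ) (p := a) hi⟩

theorem ZT.pos_of_coeff {a : ZT} {n : ℕ} (h : a ∈ ZT.low (n + 1)) (h0 : 0 < ZT.coeff n a) :
    0 < a := by
  rw [ZT.pos_iff_lc]
  have hn : Polynomial.natDegree (R := ℤ) a = n := by
    refine le_antisymm ?_ (Polynomial.le_natDegree_of_ne_zero h0.ne')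
    exact Polynomial.natDegree_le_iff_coeff_eq_zero.2 fun i hi => h i hi
  rw [← hn] at h0
  exact h0

theorem ZT.exists_coeff_of_pos {a : ZT} (h : 0 < a) :
    ∃ n, a ∈ ZT.low (n + 1) ∧ 0 < ZT.coeff n a := by
  rw [ZT.pos_iff_lc] at h
  exact ⟨Polynomial.natDegree (R := ℤ) a, fun _ hi =>
    Polynomial.coeff_eq_zero_of_natDegree_lt (R := ℤ) (p := a) hi, h⟩

/-- The monomial `t ^ n`. -/
noncomputable def ZT.tpow (n : ℕ) : ZT := (Polynomial.X ^ n : Polynomial ℤ)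

theorem ZT.coeff_tpow (i n : ℕ) : ZT.coeff i (ZT.tpow n) = if i = n then 1 else 0 :=
  Polynomial.coeff_X_pow n i

theorem ZT.tpow_zero : ZT.tpow 0 = 1 := pow_zero (Polynomial.X : Polynomial ℤ)

theorem ZT.tpow_mem {m n : ℕ} (h : m < n) : ZT.tpow m ∈ ZT.low n := fun i hi => by
  rw [ZT.coeff_tpow, if_neg (by omega)]

theorem ZT.isConvex_low {n : ℕ} (hn : 0 < n) : IsConvex (ZT.low n) where
  one_mem := by
    rw [← ZT.tpow_zero]
    exact ZT.tpow_mem hn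
  mem_of_le {a b} h0 hab hb := by
    by_contra ha
    have ha0 : 0 < a := lt_of_le_of_ne h0 fun h => ha (h ▸ zero_mem _)
    obtain ⟨N, h1, h2⟩ := ZT.exists_coeff_of_pos ha0
    have hN : n ≤ N := by
      by_contra h
      exact ha (ZT.low_mono (by omega) h1)
    refine not_lt.2 hab (sub_pos.1 (ZT.pos_of_coeff (n := N) ?_ ?_))
    · exact sub_mem h1 (ZT.low_mono (by omega) hb)
    · rw [map_sub, hb N hN, sub_zero]
      exact h2

/-- Truncation: the part of degree less than `n`. -/
noncomputable def ZT.trunc (n : ℕ) : ZT →+ ZT where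
  toFun a := (∑ i ∈ Finset.range n, Polynomial.monomial i (ZT.coeff i a) : Polynomial ℤ)
  map_zero' := by simp only [map_zero, Finset.sum_const_zero]; rfl
  map_add' a b := by simp only [map_add, Finset.sum_add_distrib]; rfl

theorem ZT.coeff_trunc (n i : ℕ) (a : ZT) :
    ZT.coeff i (ZT.trunc n a) = if i < n then ZT.coeff i a else 0 := by
  change Polynomial.coeff (∑ i ∈ Finset.range n, Polynomial.monomial i (ZT.coeff i a)) i = _
  simp [Polynomial.finsetSum_coeff, Polynomial.coeff_monomial]

/-- With N = deg α, the group B consists of the polynomials of degree at most N, τ = t^d and T =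
t^(d+1). All large d are allowed, so that C can also be made to contain the lengths needed for H. -/
theorem exists_scale {α : ZT} (hα : 0 < α) : ∃ D, ∀ d, D ≤ d → ∃ B tr cf τ T,
    Scale α B (ZT.low (d + 1)) tr cf τ T := by
  obtain ⟨N, h1, h2⟩ := ZT.exists_coeff_of_pos hα
  refine ⟨N + 1, fun d hd => ⟨ZT.low (N + 1), ZT.trunc (N + 1), ZT.coeff d, ZT.tpow d,
    ZT.tpow (d + 1), ?_⟩⟩
  have hT : ZT.coeff (d + 1) (ZT.tpow (d + 1)) = 1 := by rw [ZT.coeff_tpow, if_pos rfl]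
  exact
    { convB := ZT.isConvex_low N.succ_pos
      convC := ZT.isConvex_low d.succ_pos
      le := ZT.low_mono (by omega)
      pos := hα
      mem := h1
      arch := fun β hβ => by
        refine ⟨(ZT.coeff N β).natAbs + 1, sub_pos.1 (ZT.pos_of_coeff (n := N) ?_ ?_)⟩ <;>
          rw [← nsmul_eq_mul]
        · exact sub_mem (nsmul_mem h1 _) hβ
        · rw [map_sub, map_nsmul, nsmul_eq_mul]
          have := le_mul_of_one_le_right (a := (((ZT.coeff N β).natAbs + 1 : ℕ) : ℤ))
            (by positivity) (Int.add_one_le_iff.2 h2)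
          omega
      tr_mem := fun β i hi => by rw [ZT.coeff_trunc, if_neg (by omega)]
      tr_id := fun β hβ => ZT.ext_coeff fun i => by
        rw [ZT.coeff_trunc]
        split_ifs with h
        · rfl
        · exact (hβ i (by omega)).symm
      tr_top := ZT.ext_coeff fun i => by
        rw [ZT.coeff_trunc, map_zero, ZT.coeff_tpow]
        split_ifs <;> omega
      top_pos := ZT.pos_of_coeff (ZT.tpow_mem (Nat.lt_succ_self _)) (by rw [hT]; exact one_pos)
      top_not_mem := fun h => by
        rw [h (d + 1) le_rfl] at hT
        exact zero_ne_one hT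
      τ_mem := ZT.tpow_mem (Nat.lt_succ_self d)
      cf_τ := by rw [ZT.coeff_tpow, if_pos rfl]
      cf_B := fun β hβ => hβ d hd
      cf_pos := fun β hβ h => ZT.pos_of_coeff hβ h }

end coefficients

/-! ### From the HNN extension to words -/

section embedding

variable {G : Type*} [Group G] {S : Set G}

/-- The elements of `Ext(A,G)` represented by words with length in `C`. -/
noncomputable def shortElements (S : Set G) (C : AddSubgroup ZT) : Subgroup (Ext S) where
  carrier := {g | ∃ x ∈ Submonoid.closure {u : Word (Letters S) | GReduced u},
    x.len ∈ C ∧ toM S x = g}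
  one_mem' := ⟨1, one_mem _, one_len_mem, map_one _⟩
  mul_mem' := by
    rintro a b ⟨x, hx, h1, h2⟩ ⟨y, hy, h3, h4⟩
    exact ⟨x * y, mul_mem hx hy, mul_len_mem h1 h3, by rw [map_mul, h2, h4]; rfl⟩
  inv_mem' := by
    rintro a ⟨x, hx, h1, h2⟩
    have key : x.bar ∈ Submonoid.closure {u : Word (Letters S) | GReduced u} ∧
        toM S x.bar * toM S x = 1 := by
      clear h1 h2
      induction hx using Submonoid.closure_induction with
      | mem u hu => exact ⟨Submonoid.subset_closure hu.bar, toM_bar_mul hu⟩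
      | one => exact ⟨by rw [bar_one]; exact one_mem _, by rw [bar_one, map_one, one_mul]⟩
      | mul x y _ _ hx hy =>
        refine ⟨by rw [bar_mul]; exact mul_mem hy.1 hx.1, ?_⟩
        rw [bar_mul, map_mul, map_mul, mul_assoc, ← mul_assoc (toM S x.bar), hx.2, one_mul, hy.2]
    refine ⟨x.bar, key.1, h1, ?_⟩
    have h3 : (a : MonM S) * ((a⁻¹ : Ext S) : MonM S) = 1 :=
      congrArg Subtype.val (mul_inv_cancel a)
    rw [← mul_one (toM S x.bar), ← h3, ← mul_assoc, ← h2, key.2, one_mul]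

theorem exists_le_shortElements {H : Subgroup (Ext S)} (hH : H.FG) :
    ∃ n, ∀ m, n ≤ m → H ≤ shortElements S (ZT.low m) := by
  obtain ⟨s, rfl⟩ := hH
  have h : ∀ g : Ext S, ∃ n, g ∈ shortElements S (ZT.low n) := by
    rintro ⟨_, x, hx, rfl⟩
    obtain ⟨n, hn⟩ := ZT.exists_mem_low x.len
    exact ⟨n, x, hx, hn, rfl⟩
  choose n hn using h
  refine ⟨s.sup n, fun m hm => (Subgroup.closure_le _).2 fun g hg => ?_⟩
  obtain ⟨x, hx, h1, h2⟩ := hn g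
  exact ⟨x, hx, ZT.low_mono ((Finset.le_sup hg).trans hm) h1, h2⟩

theorem coe_inv_eq_toM_bar {g : Ext S} {x : Word (Letters S)} (hx : GReduced x)
    (h : (g : MonM S) = toM S x) : ((g⁻¹ : Ext S) : MonM S) = toM S x.bar := by
  have h3 : (g : MonM S) * ((g⁻¹ : Ext S) : MonM S) = 1 :=
    congrArg Subtype.val (mul_inv_cancel g)
  rw [← mul_one (toM S x.bar), ← h3, ← mul_assoc, h, toM_bar_mul hx, one_mul]

/-- The powers of x are nonempty reduced words, which are nontrivial in M(A,G). -/
theorem orderOf_eq_zero_of_cyclicallyGReduced {g : Ext S} {x : Word (Letters S)}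
    (hx : CyclicallyGReduced x) (h : (g : MonM S) = toM S x) (hl : 0 < x.len) :
    orderOf g = 0 := by
  rw [orderOf_eq_zero_iff']
  intro n hn h1
  have h2 : toM S (x ^ n) = 1 := by
    rw [map_pow, ← h]
    exact congrArg Subtype.val h1
  have h3 := congrArg len ((null_of_toM h2).eq_one (hx n))
  rw [len_pow, len_one] at h3
  exact (mul_pos (Nat.cast_pos.2 hn) hl).ne' h3

theorem exists_form {C : AddSubgroup ZT} {s : Word (Letters S)} {H : Subgroup (Ext S)}
    (hH : H ≤ shortElements S C) (L : List (ℤˣ × H)) (m : H) :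
    ∃ Y, Form C s ((m : Ext S) : MonM S) (L.map fun a => (a.1, ((a.2 : Ext S) : MonM S))) Y ∧
      toM S Y = ((m : Ext S) : MonM S) *
        (L.map fun a => toM S (signed s a.1) * ((a.2 : Ext S) : MonM S)).prod := by
  obtain ⟨x, -, hx, hxm⟩ := hH m.2
  induction L generalizing m x with
  | nil => exact ⟨x, ⟨hx, hxm⟩, by rw [hxm, List.map_nil, List.prod_nil, mul_one]⟩
  | cons a L ih =>
    obtain ⟨y, -, hy, hym⟩ := hH a.2.2
    obtain ⟨Y, h1, h2⟩ := ih a.2 y hy hym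
    refine ⟨x * (signed s a.1 * Y), ⟨x, signed s a.1, Y, 1, 1, rfl, by rw [one_mul, mul_one], hx,
      one_len_mem, one_len_mem, by rw [map_one, mul_one, hxm], by rwa [map_one, one_mul]⟩, ?_⟩
    rw [map_mul, map_mul, h2, hxm, List.map_cons, List.prod_cons]
    simp only [mul_assoc]

theorem toM_pow_mem_zpowers {H : Subgroup (Ext S)} {g h : H} {x : Word (Letters S)}
    (hx : CyclicallyGReduced x) (hg : ((g : Ext S) : MonM S) = toM S x) {k : ℕ}
    (hh : ((h : Ext S) : MonM S) = toM S (x ^ k) ∨ ((h : Ext S) : MonM S) = toM S (x ^ k).bar) :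
    h ∈ Subgroup.zpowers g := by
  have h1 : (((g ^ k : H) : Ext S) : MonM S) = toM S (x ^ k) := by
    rw [map_pow, ← hg]
    rfl
  rcases hh with hh | hh
  · have : h = g ^ k := Subtype.ext (Subtype.ext (hh.trans h1.symm))
    rw [this]
    exact Subgroup.npow_mem_zpowers g k
  · have : h = (g ^ k)⁻¹ := Subtype.ext (Subtype.ext (hh.trans (coe_inv_eq_toM_bar (hx k) h1).symm))
    rw [this]
    exact inv_mem (Subgroup.npow_mem_zpowers g k)

/-- Translates the condition on reduced words in HNN extensions: between t and t⁻¹ there is no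
element of ⟨v⟩, and between t⁻¹ and t none of ⟨u⟩. -/
theorem noPinch_of_isChain {u v : Word (Letters S)} (hu : CyclicallyGReduced u)
    (hv : CyclicallyGReduced v) {H : Subgroup (Ext S)} {a b : H}
    (ha : ((a : Ext S) : MonM S) = toM S u) (hb : ((b : Ext S) : MonM S) = toM S v)
    {L : List (ℤˣ × H)} (hL : L.IsChain fun x y => x.2 ∈ HNNExtension.toSubgroup
      (Subgroup.zpowers b) (Subgroup.zpowers a) x.1 → x.1 = y.1) :
    NoPinch (fun e => if e = 1 then u else v.bar)
      (L.map fun a => (a.1, ((a.2 : Ext S) : MonM S))) := by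
  intro L₁ L₂ e h h' hLe k
  obtain ⟨l₁, l₂, rfl, -, h2⟩ := List.map_eq_append_iff.1 hLe
  obtain ⟨⟨e₁, g⟩, l₃, rfl, h3, h4⟩ := List.map_eq_cons_iff.1 h2
  obtain ⟨⟨e₂, g'⟩, l₄, rfl, h5, h6⟩ := List.map_eq_cons_iff.1 h4
  obtain ⟨rfl, rfl⟩ := Prod.mk.inj h3
  obtain ⟨rfl, rfl⟩ := Prod.mk.inj h5
  have h7 := (List.isChain_cons_cons.1 (List.isChain_append.1 hL).2.1).1
  have h8 : g ∉ HNNExtension.toSubgroup (Subgroup.zpowers b) (Subgroup.zpowers a) e₁ := by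
    intro h9
    have h10 : e₁ = -e₁ := h7 h9
    rcases Int.units_eq_one_or e₁ with rfl | rfl <;> exact absurd h10 (by decide)
  rw [← not_or]
  intro h9
  apply h8
  rcases Int.units_eq_one_or e₁ with rfl | rfl
  · rw [HNNExtension.toSubgroup_one]
    change ((g : Ext S) : MonM S) = toM S (v.bar ^ k) ∨
      ((g : Ext S) : MonM S) = toM S (v.bar ^ k).bar at h9
    rw [← bar_pow, bar_bar, or_comm] at h9
    exact toM_pow_mem_zpowers hv hb h9
  · rw [HNNExtension.toSubgroup_neg_one]
    rw [neg_neg] at h9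
    exact toM_pow_mem_zpowers hu ha h9

end embedding

end InfWords

theorem mainTheorem6 {G : Type*} [Group G] (S : Set G) (hS : Subgroup.closure S = ⊤)
    (hS1 : (1 : G) ∉ S) (H : Subgroup (InfWords.Ext S)) (hH : H.FG)
    (u v w : InfWords.Word (InfWords.Letters S))
    (hu : InfWords.CyclicallyGReduced u) (hv : InfWords.CyclicallyGReduced v)
    (hw : InfWords.CyclicallyGReduced w)
    (huv : u.len = v.len) (hvw : v.len = w.len) (hprim : w.Primitive)
    (a b c : H)
    (ha : ((a : InfWords.Ext S) : InfWords.MonM S) = InfWords.toM S u)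
    (hb : ((b : InfWords.Ext S) : InfWords.MonM S) = InfWords.toM S v)
    (hc : ((c : InfWords.Ext S) : InfWords.MonM S) = InfWords.toM S w)
    (hCa : IsCyclic (Subgroup.centralizer {a})) (hCb : IsCyclic (Subgroup.centralizer {b})) :
    ∃ φ : Subgroup.zpowers b ≃* Subgroup.zpowers a,
      ((φ ⟨b, Subgroup.mem_zpowers b⟩ : Subgroup.zpowers a) : H) = a ∧
      ∃ f : HNNExtension H (Subgroup.zpowers b) (Subgroup.zpowers a) φ →* InfWords.Ext S,
        Function.Injective f ∧ ∀ h : H, f (HNNExtension.of h) = h := by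
  open InfWords in
  have hα : 0 < w.len := Word.len_pos hprim.1
  have hoa : orderOf a = 0 := by
    rw [← Subgroup.orderOf_coe]
    exact orderOf_eq_zero_of_cyclicallyGReduced hu ha (by rwa [huv, hvw])
  have hob : orderOf b = 0 := by
    rw [← Subgroup.orderOf_coe]
    exact orderOf_eq_zero_of_cyclicallyGReduced hv hb (by rwa [hvw])
  obtain ⟨φ, hφ⟩ : ∃ φ : Subgroup.zpowers b ≃* Subgroup.zpowers a,
      φ ⟨b, Subgroup.mem_zpowers b⟩ = ⟨a, Subgroup.mem_zpowers a⟩ := by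
    have gen : ∀ g : H, ∀ x : Subgroup.zpowers g,
        x ∈ Subgroup.zpowers (⟨g, Subgroup.mem_zpowers g⟩ : Subgroup.zpowers g) := by
      rintro g ⟨_, k, rfl⟩
      exact ⟨k, Subtype.ext rfl⟩
    exact ⟨mulEquivOfOrderOfEq (gen b) (gen a) (by rw [Subgroup.orderOf_mk, hob,
      Subgroup.orderOf_mk, hoa]), mulEquivOfOrderOfEq_apply_gen ..⟩
  obtain ⟨D, hD⟩ := exists_scale hα
  obtain ⟨n, hn⟩ := exists_le_shortElements hH
  -- The degree must exceed that of α and also make C contain lengths of representatives for all of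
  -- H.
  obtain ⟨B, tr, cf, τ, T, hsc⟩ := hD (max D n) (le_max_left _ _)
  have hshort := hn (max D n + 1) ((le_max_right _ _).trans (Nat.le_succ _))
  have hst := hsc.isStable (huv.trans hvw) hvw rfl hu hv hw hprim
  set C := ZT.low (max D n + 1)
  set s := hsc.word (huv.trans hvw) hvw rfl with hs
  let t : Ext S := ⟨toM S s, toM_mem_Ext hst.reduced⟩
  have hcomm : SemiconjBy t (b : Ext S) (a : Ext S) := by
    refine Subtype.ext ?_
    change toM S s * ((b : Ext S) : MonM S) = ((a : Ext S) : MonM S) * toM S s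
    rw [ha, hb, ← map_mul, ← map_mul, hs, hsc.word_comm]
  have hx : ∀ g : Subgroup.zpowers b,
      t * H.subtype (g : H) = H.subtype (φ g : Subgroup.zpowers a) * t := by
    rintro ⟨_, k, rfl⟩
    have h1 : (⟨b ^ k, k, rfl⟩ : Subgroup.zpowers b) = ⟨b, Subgroup.mem_zpowers b⟩ ^ k :=
      Subtype.ext rfl
    change t * H.subtype (b ^ k) = H.subtype (φ ⟨b ^ k, k, rfl⟩ : Subgroup.zpowers a) * t
    rw [h1, map_zpow φ, hφ]
    exact hcomm.zpow_right k
  refine ⟨φ, by rw [hφ], HNNExtension.lift H.subtype t hx, ?_, fun h => by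
    rw [HNNExtension.lift_of]; rfl⟩
  rw [injective_iff_map_eq_one]
  intro g hg
  obtain ⟨d⟩ := HNNExtension.NormalWord.TransversalPair.nonempty H (Subgroup.zpowers b)
    (Subgroup.zpowers a)
  -- A reduced expression for g is obtained by letting g act on the empty normal word.
  obtain ⟨r, rfl⟩ : ∃ r : HNNExtension.NormalWord.ReducedWord H (Subgroup.zpowers b)
      (Subgroup.zpowers a), r.prod φ = g :=
    ⟨(g • (HNNExtension.NormalWord.empty : HNNExtension.NormalWord d)).toReducedWord, by
      rw [HNNExtension.NormalWord.prod_smul, HNNExtension.NormalWord.prod_empty, mul_one]⟩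
  by_cases hr : r.toList = []
  · rw [HNNExtension.NormalWord.ReducedWord.prod, hr, List.map_nil, List.prod_nil, mul_one] at hg ⊢
    rw [HNNExtension.lift_of] at hg
    rw [H.subtype_injective (hg.trans (map_one _).symm), map_one]
  exfalso
  obtain ⟨Y, h1, h2⟩ := exists_form (s := s) hshort r.toList r.head
  refine h1.not_null hsc.convC hst (noPinch_of_isChain hu hv ha hb r.chain) (by simpa using hr)
    (null_of_toM ?_)
  have htz : ∀ e : ℤˣ, ((t ^ (e : ℤ) : Ext S) : MonM S) = toM S (signed s e) := by
    intro e
    rcases Int.units_eq_one_or e with rfl | rfl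
    · rw [signed_one]
      exact congrArg Subtype.val (zpow_one t)
    · rw [signed_neg_one, ← coe_inv_eq_toM_bar (g := t) hst.reduced rfl]
      exact congrArg Subtype.val (zpow_neg_one t)
  rw [h2]
  rw [HNNExtension.NormalWord.ReducedWord.prod, map_mul, HNNExtension.lift_of, map_list_prod,
    List.map_map] at hg
  have h3 := congrArg (Ext S).subtype hg
  rw [map_mul, map_one, map_list_prod, List.map_map] at h3
  rw [← h3]
  congr 2
  refine List.map_congr_left fun x _ => ?_
  simp only [Function.comp_apply, map_mul, map_zpow, HNNExtension.lift_t, HNNExtension.lift_of]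
  rw [← htz]
  rfl
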